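/- Two parties, Alice and Bob, have machines with finite-dimensional Hilbert spaces $\mathcal H_A,\mathcal H_B$ and share a channel $\mathcal H_C$. A commitment protocol $P$ for strings $x\in\{0,1\}^n$ consists of initial pure states (Alice's depending on $x$), a commit phase and a reveal phase. Each phase is a fixed finite number of rounds; in a round Alice applies a unitary on $\mathcal H_A\otimes\mathcal H_C$ and then Bob applies a unitary on $\mathcal H_B\otimes\mathcal H_C$. At the very end Bob performs a measurement on $\mathcal H_B$ whose outcome is either a string $x$ ("the opening of $x$ is accepted") or "reject". Let $\rho_x$ be Bob's reduced state on $\mathcal H_B$ after an honest commit phase with input $x$, and let $\mathcal E=\{2^{-n},\rho_x\}$. For real $a,b$, $P$ is an $(n,a,b)$-QBSC if * (correctness) when both parties are honest and Alice's input is $x$, Bob accepts $x$ with probability $1$; * (concealing) $\sum_x \operatorname{Tr}(M_x\rho_x)\le 2^b$ for every measurement $(M_x)_{x\in\{0,1\}^n}$ on $\mathcal H_B$; * (binding) when Bob is honest, for every commit strategy of Alice (any finite-dimensional machine, initial state and unitaries on her machine and the channel), $\sum_x p^A_x\le 2^a$ whenever, for each $x$, $p^A_x$ is the probability that Bob accepts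 $x$ under some strategy of Alice in the reveal phase. It is an $(n,a,b)$-QBSC$_\chi$ if the concealing condition is replaced by $\chi(\mathcal E)\le b$, where $\chi(\mathcal E)=S\big(2^{-n}\sum_x\rho_x\big)-2^{-n}\sum_x S(\rho_x)$ is the Holevo information and $S(\rho)=-\operatorname{Tr}\rho\log_2\rho$. The $m$-fold parallel repetition $P^m$ is the protocol for strings of length $mn$ in which $P$ is run simultaneously and independently on the $m$ blocks of length $n$, Bob accepting the whole string iff he accepts in all $m$ runs. **Corollary.** Let $c=5\log_2 5-4$. 1. If $m\ge1$, $P$ is an $(n,a,b)$-QBSC and $P^m$ is an $(mn,ma,mb)$-QBSC, then $n<a+b+c/m$. 2. Consequently no QBSC with $a+b<n$ can be executed securely in parallel an arbitrary number of times: for every commitment protocol $P$ for $n$-bit strings (in particular for every $(n,a,b)$-QBSC) with $a+b<n$ there is an $M$ such that for no $m\ge M$ is $P^m$ an $(mn,ma,mb)$-QBSC. 3. The same holds for the Holevo information: for every commitment protocol $P$ for $n$-bit strings (in particular for every $(n,a,b)$-QBSC$_\chi$) with $a+b<n$ there is an $M$ such that for no $m\ge M$ is $P^m$ an $(mn,ma,mb)$-QBSC$_\chi$.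 -/

import Mathlib

noncomputable section

namespace QBSC

open scoped ComplexOrder MatrixOrder

/-- The strings `{0,1}^n`. -/
abbrev BitString (n : ℕ) : Type := Fin n → Bool

/-! ### Finite-dimensional quantum mechanics -/

/-- A unit vector of the Hilbert space `ℂ^S`. -/
structure PureState (S : Type) [Fintype S] where
  amp : S → ℂ
  norm_eq_one : ∑ s, ‖amp s‖ ^ 2 = 1

/-- A density operator on `ℂ^B`. -/
structure DensityMatrix (B : Type) [Fintype B] where
  mat : Matrix B B ℂ
  posSemidef : mat.PosSemidef
  trace_eq_one : mat.trace = 1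

/-- A measurement on `ℂ^B` with outcomes in `ι`. -/
structure POVM (ι B : Type) [Fintype ι] [Fintype B] [DecidableEq B] where
  effect : ι → Matrix B B ℂ
  posSemidef : ∀ i, (effect i).PosSemidef
  sum_eq_one : ∑ i, effect i = 1

/-- Born rule: probability of outcome `i` when `ρ` is measured with `M`. -/
def POVM.prob {ι B : Type} [Fintype ι] [Fintype B] [DecidableEq B]
    (M : POVM ι B) (ρ : DensityMatrix B) (i : ι) : ℝ :=
  (M.effect i * ρ.mat).trace.re

/-- Von Neumann entropy `-Tr ρ log₂ ρ`, in bits. -/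
def DensityMatrix.entropy {B : Type} [Fintype B] [DecidableEq B] (ρ : DensityMatrix B) : ℝ :=
  (∑ i, Real.negMulLog (ρ.posSemidef.isHermitian.eigenvalues i)) / Real.log 2

/-- An ensemble `{p_x, ρ_x}` of quantum states. -/
structure Ensemble (X B : Type) [Fintype X] [Fintype B] where
  prob : X → ℝ
  prob_nonneg : ∀ x, 0 ≤ prob x
  prob_sum : ∑ x, prob x = 1
  state : X → DensityMatrix B

/-- The average state `ρ = ∑ p_x ρ_x`. -/
def Ensemble.average {X B : Type} [Fintype X] [Fintype B] (E : Ensemble X B) :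
    DensityMatrix B where
  mat := ∑ x, (E.prob x : ℂ) • (E.state x).mat
  posSemidef := by
    refine Matrix.posSemidef_sum _ fun x _ => ?_
    refine (E.state x).posSemidef.smul ?_
    exact_mod_cast E.prob_nonneg x
  trace_eq_one := by
    simp only [Matrix.trace_sum, Matrix.trace_smul, DensityMatrix.trace_eq_one, smul_eq_mul,
      mul_one]
    exact_mod_cast E.prob_sum

/-- The Holevo information `χ = S(∑ p_x ρ_x) - ∑ p_x S(ρ_x)`, in bits. -/
def Ensemble.holevo {X B : Type} [Fintype X] [Fintype B] [DecidableEq B]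
    (E : Ensemble X B) : ℝ :=
  E.average.entropy - ∑ x, E.prob x * (E.state x).entropy

theorem sum_norm_sq_mulVec {S : Type} [Fintype S] [DecidableEq S]
    (U : Matrix.unitaryGroup S ℂ) (v : S → ℂ) :
    ∑ s, ‖∑ t, (U : Matrix S S ℂ) s t * v t‖ ^ 2 = ∑ s, ‖v s‖ ^ 2 := by
  have key : ∀ w : S → ℂ, ((∑ s, ‖w s‖ ^ 2 : ℝ) : ℂ) = star w ⬝ᵥ w := by
    intro w
    simp only [dotProduct, Pi.star_apply, RCLike.star_def]
    push_cast
    exact Finset.sum_congr rfl fun s _ => (Complex.conj_mul' (w s)).symm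
  have h : star ((U : Matrix S S ℂ).mulVec v) ⬝ᵥ ((U : Matrix S S ℂ).mulVec v)
      = star v ⬝ᵥ v := by
    rw [Matrix.star_mulVec, Matrix.dotProduct_mulVec, Matrix.vecMul_vecMul,
      ← Matrix.star_eq_conjTranspose, Matrix.UnitaryGroup.star_mul_self, Matrix.vecMul_one]
  rw [← key, ← key] at h
  exact_mod_cast h

/-! ### Two-party protocols on `H_A ⊗ H_B ⊗ H_C` (Alice, Bob, channel) -/

section Model

variable {A B C : Type} [Fintype A] [Fintype B] [Fintype C]

/-- The product state `α ⊗ β ⊗ γ`. -/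
def PureState.prod (α : PureState A) (β : PureState B) (γ : PureState C) :
    PureState (A × B × C) where
  amp s := α.amp s.1 * β.amp s.2.1 * γ.amp s.2.2
  norm_eq_one := by
    simp only [Fintype.sum_prod_type, norm_mul, mul_pow]
    simp only [← Finset.mul_sum, γ.norm_eq_one, β.norm_eq_one,
      α.norm_eq_one, mul_one]

/-- Alice applies a unitary on `H_A ⊗ H_C`. -/
def aliceStep [DecidableEq A] [DecidableEq C] (U : Matrix.unitaryGroup (A × C) ℂ)
    (ψ : PureState (A × B × C)) : PureState (A × B × C) where
  amp s := ∑ t : A × C, (U : Matrix (A × C) (A × C) ℂ) (s.1, s.2.2) t * ψ.amp (t.1, s.2.1, t.2)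
  norm_eq_one := by
    have h : ∀ f : A × B × C → ℝ, ∑ s, f s = ∑ b, ∑ t : A × C, f (t.1, b, t.2) := by
      intro f
      simp only [Fintype.sum_prod_type]
      exact Finset.sum_comm
    rw [h, ← ψ.norm_eq_one, h (fun s => ‖ψ.amp s‖ ^ 2)]
    exact Finset.sum_congr rfl fun b _ =>
      sum_norm_sq_mulVec U fun t => ψ.amp (t.1, b, t.2)

/-- Bob applies a unitary on `H_B ⊗ H_C`. -/
def bobStep [DecidableEq B] [DecidableEq C] (V : Matrix.unitaryGroup (B × C) ℂ)
    (ψ : PureState (A × B × C)) : PureState (A × B × C) where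
  amp s := ∑ t : B × C, (V : Matrix (B × C) (B × C) ℂ) s.2 t * ψ.amp (s.1, t)
  norm_eq_one := by
    rw [← ψ.norm_eq_one, Fintype.sum_prod_type, Fintype.sum_prod_type]
    exact Finset.sum_congr rfl fun a _ => sum_norm_sq_mulVec V fun t => ψ.amp (a, t)

/-- The joint state after `k` rounds. In round `i` Alice applies `U i` to her machine and the
channel, and then Bob applies `V i` to his machine and the channel. -/
def evolve [DecidableEq A] [DecidableEq B] [DecidableEq C]
    (U : ℕ → Matrix.unitaryGroup (A × C) ℂ) (V : ℕ → Matrix.unitaryGroup (B × C) ℂ)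
    (ψ : PureState (A × B × C)) : ℕ → PureState (A × B × C)
  | 0 => ψ
  | k + 1 => bobStep (V k) (aliceStep (U k) (evolve U V ψ k))

/-- Bob's reduced density operator (partial trace over `H_A` and `H_C`). -/
def bobReduced (ψ : PureState (A × B × C)) : DensityMatrix B where
  mat := Matrix.of fun b b' => ∑ t : A × C, ψ.amp (t.1, b, t.2) * star (ψ.amp (t.1, b', t.2))
  posSemidef := Matrix.posSemidef_self_mul_conjTranspose
    (Matrix.of fun (b : B) (t : A × C) => ψ.amp (t.1, b, t.2))
  trace_eq_one := by
    simp only [Matrix.trace, Matrix.diag_apply, Matrix.of_apply, RCLike.star_def,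
      Complex.mul_conj']
    have h := ψ.norm_eq_one
    simp only [Fintype.sum_prod_type] at h ⊢
    rw [Finset.sum_comm] at h
    exact_mod_cast h

end Model

/-- A two-party quantum protocol for committing to `n`-bit strings. Both parties act unitarily;
only the first `commitRounds` (`revealRounds`) entries of the sequences of unitaries of the commit
(reveal) phase are used. Honest Alice's input `x` is encoded in the initial pure state of her
machine. At the very end Bob measures his machine: outcome `some x` means that he accepts the
opening of `x`, outcome `none` means that he rejects. -/
structure Protocol (n : ℕ) where
  A : Type
  B : Type
  C : Type
  [fintypeA : Fintype A]
  [fintypeB : Fintype B]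
  [fintypeC : Fintype C]
  [decEqA : DecidableEq A]
  [decEqB : DecidableEq B]
  [decEqC : DecidableEq C]
  aliceInit : BitString n → PureState A
  bobInit : PureState B
  channelInit : PureState C
  commitRounds : ℕ
  aliceCommit : ℕ → Matrix.unitaryGroup (A × C) ℂ
  bobCommit : ℕ → Matrix.unitaryGroup (B × C) ℂ
  revealRounds : ℕ
  aliceReveal : ℕ → Matrix.unitaryGroup (A × C) ℂ
  bobReveal : ℕ → Matrix.unitaryGroup (B × C) ℂ
  opening : POVM (Option (BitString n)) B

attribute [instance] Protocol.fintypeA Protocol.fintypeB Protocol.fintypeC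
  Protocol.decEqA Protocol.decEqB Protocol.decEqC

namespace Protocol

variable {n : ℕ} (P : Protocol n)

/-- The joint state after the commit phase when Bob is honest and Alice uses a machine `A'` with
initial state `α` and unitaries `U`. -/
def afterCommit {A' : Type} [Fintype A'] [DecidableEq A'] (α : PureState A')
    (U : ℕ → Matrix.unitaryGroup (A' × P.C) ℂ) : PureState (A' × P.B × P.C) :=
  evolve U P.bobCommit (α.prod P.bobInit P.channelInit) P.commitRounds

/-- The probability that honest Bob accepts the opening of `x`, if the reveal phase starts from
the joint state `ψ` and Alice uses the unitaries `U`. -/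
def acceptProb {A' : Type} [Fintype A'] [DecidableEq A'] (ψ : PureState (A' × P.B × P.C))
    (U : ℕ → Matrix.unitaryGroup (A' × P.C) ℂ) (x : BitString n) : ℝ :=
  P.opening.prob (bobReduced (evolve U P.bobReveal ψ P.revealRounds)) (some x)

/-- The joint state `|φ_x⟩` after an honest commit phase with input `x`. -/
def honestState (x : BitString n) : PureState (P.A × P.B × P.C) :=
  P.afterCommit (P.aliceInit x) P.aliceCommit

/-- The ensemble `{p_x, ρ_x}` with `p_x = 2^{-n}` and `ρ_x` Bob's state after an honest commit
phase with input `x`. -/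
def ensemble : Ensemble (BitString n) P.B where
  prob _ := ((2 : ℝ) ^ n)⁻¹
  prob_nonneg _ := by positivity
  prob_sum := by simp
  state x := bobReduced (P.honestState x)

/-- If both parties are honest, Bob accepts and learns `x`. -/
def Correct : Prop :=
  ∀ x, P.acceptProb (P.honestState x) P.aliceReveal x = 1

/-- `∑_x p^B_{x|x} ≤ 2^b` for every measurement by which Bob guesses `x` before the reveal phase. -/
def Concealing (b : ℝ) : Prop :=
  ∀ M : POVM (BitString n) P.B, ∑ x, M.prob (P.ensemble.state x) x ≤ (2 : ℝ) ^ b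

/-- `∑_x p^A_x ≤ 2^a` against honest Bob, for every commitment of Alice (an arbitrary machine `A'`,
initial state and unitaries) and all her strategies `R x` to reveal `x` afterwards. -/
def Binding (a : ℝ) : Prop :=
  ∀ (A' : Type) [Fintype A'] [DecidableEq A'] (α : PureState A')
    (U : ℕ → Matrix.unitaryGroup (A' × P.C) ℂ)
    (R : BitString n → ℕ → Matrix.unitaryGroup (A' × P.C) ℂ),
    ∑ x, P.acceptProb (P.afterCommit α U) (R x) x ≤ (2 : ℝ) ^ a

/-- `P` is an `(n,a,b)`-QBSC. -/
structure IsQBSC (a b : ℝ) : Prop where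
  correct : P.Correct
  concealing : P.Concealing b
  binding : P.Binding a

/-- `P` is an `(n,a,b)`-QBSC with the Holevo information `χ` as measure of concealment. -/
structure IsQBSCHolevo (a b : ℝ) : Prop where
  correct : P.Correct
  concealing : P.ensemble.holevo ≤ b
  binding : P.Binding a

end Protocol

/-! ### Parallel repetition -/

/-- The tensor product of `m` matrices. -/
def tensor {m : ℕ} {S : Type} (M : Fin m → Matrix S S ℂ) :
    Matrix (Fin m → S) (Fin m → S) ℂ :=
  Matrix.of fun f g => ∏ i, M i (f i) (g i)

theorem tensor_mul {m : ℕ} {S : Type} [Fintype S] (M N : Fin m → Matrix S S ℂ) :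
    tensor M * tensor N = tensor fun i => M i * N i := by
  ext f g
  simp only [tensor, Matrix.mul_apply, Matrix.of_apply, Finset.prod_univ_sum,
    Fintype.piFinset_univ, Finset.prod_mul_distrib]

theorem tensor_one {m : ℕ} {S : Type} [DecidableEq S] :
    tensor (fun _ : Fin m => (1 : Matrix S S ℂ)) = 1 := by
  ext f g
  simp only [tensor, Matrix.of_apply, Matrix.one_apply, Finset.prod_ite_zero, Finset.mem_univ,
    true_imp_iff, Finset.prod_const_one, funext_iff]

theorem tensor_conjTranspose {m : ℕ} {S : Type} (M : Fin m → Matrix S S ℂ) :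
    (tensor M).conjTranspose = tensor fun i => (M i).conjTranspose := by
  ext f g
  simp [tensor, Matrix.conjTranspose_apply]

theorem tensor_posSemidef {m : ℕ} {S : Type} [Fintype S] [DecidableEq S]
    {M : Fin m → Matrix S S ℂ} (h : ∀ i, (M i).PosSemidef) : (tensor M).PosSemidef := by
  have h' : ∀ i, ∃ N : Matrix S S ℂ, M i = N.conjTranspose * N := fun i =>
    CStarAlgebra.nonneg_iff_eq_star_mul_self.mp (h i).nonneg
  choose N hN using h'
  have : tensor M = (tensor N).conjTranspose * tensor N := by
    rw [tensor_conjTranspose, tensor_mul]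
    exact congrArg tensor (funext hN)
  rw [this]
  exact Matrix.posSemidef_conjTranspose_mul_self _

/-- `m` independent copies of a state. -/
def tensorState {m : ℕ} {S : Type} [Fintype S] (ψ : Fin m → PureState S) :
    PureState (Fin m → S) where
  amp f := ∏ i, (ψ i).amp (f i)
  norm_eq_one := by
    have h := Finset.prod_univ_sum (fun _ : Fin m => (Finset.univ : Finset S))
      (fun i s => ‖(ψ i).amp s‖ ^ 2)
    simp only [PureState.norm_eq_one, Finset.prod_const_one, Fintype.piFinset_univ] at h
    simp only [norm_prod, ← Finset.prod_pow]
    exact h.symm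

/-- `U^{⊗m}`, for `U` on `ℂ^S ⊗ ℂ^T`, as a unitary on `(ℂ^S)^{⊗m} ⊗ (ℂ^T)^{⊗m}`. -/
def unitaryPow (m : ℕ) {S T : Type} [Fintype S] [Fintype T] [DecidableEq S] [DecidableEq T]
    (U : Matrix.unitaryGroup (S × T) ℂ) :
    Matrix.unitaryGroup ((Fin m → S) × (Fin m → T)) ℂ :=
  ⟨(tensor fun _ : Fin m => (U : Matrix (S × T) (S × T) ℂ)).submatrix
      (fun p i => (p.1 i, p.2 i)) (fun p i => (p.1 i, p.2 i)), by
    have e : (fun (p : (Fin m → S) × (Fin m → T)) i => (p.1 i, p.2 i))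
        = (Equiv.arrowProdEquivProdArrow (Fin m) (fun _ => S) (fun _ => T)).symm := rfl
    rw [Matrix.mem_unitaryGroup_iff, e, Matrix.star_eq_conjTranspose,
      Matrix.conjTranspose_submatrix, Matrix.submatrix_mul_equiv, tensor_conjTranspose,
      tensor_mul]
    have hU : (U : Matrix (S × T) (S × T) ℂ) * (U : Matrix (S × T) (S × T) ℂ).conjTranspose = 1 :=
      Matrix.mem_unitaryGroup_iff.mp U.2
    simp only [hU, tensor_one, Matrix.submatrix_one_equiv]⟩

/-- Perform the same measurement on each of `m` systems. -/
def POVM.pow (m : ℕ) {ι B : Type} [Fintype ι] [Fintype B] [DecidableEq B] (M : POVM ι B) :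
    POVM (Fin m → ι) (Fin m → B) where
  effect f := tensor fun i => M.effect (f i)
  posSemidef f := tensor_posSemidef fun i => M.posSemidef (f i)
  sum_eq_one := by
    rw [← tensor_one, ← M.sum_eq_one]
    ext g h
    simp only [tensor, Matrix.sum_apply, Matrix.of_apply, Finset.prod_univ_sum,
      Fintype.piFinset_univ]

/-- Perform a measurement and apply `g` to its outcome. -/
def POVM.map {ι κ B : Type} [Fintype ι] [Fintype κ] [DecidableEq κ] [Fintype B] [DecidableEq B]
    (M : POVM ι B) (g : ι → κ) : POVM κ B where
  effect k := ∑ i with g i = k, M.effect i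
  posSemidef k := Matrix.posSemidef_sum _ fun i _ => M.posSemidef i
  sum_eq_one := by
    rw [← M.sum_eq_one]
    exact Finset.sum_fiberwise _ g M.effect

/-- The `i`-th block of length `n` of a string of length `m * n`. -/
def block {m n : ℕ} (x : BitString (m * n)) (i : Fin m) : BitString n :=
  fun j => x (finProdFinEquiv (i, j))

/-- The concatenation of `m` strings of length `n`. -/
def concat {m n : ℕ} (y : Fin m → BitString n) : BitString (m * n) :=
  fun k => y (finProdFinEquiv.symm k).1 (finProdFinEquiv.symm k).2

/-- Accept the concatenated string if all `m` openings are accepted, otherwise reject. -/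
def jointOutcome {m n : ℕ} (o : Fin m → Option (BitString n)) : Option (BitString (m * n)) :=
  if h : ∀ i, (o i).isSome then some (concat fun i => (o i).get (h i)) else none

/-- The `m`-fold parallel repetition `P^m`: the string of length `m * n` is cut into `m` blocks of
length `n`, and `P` is run on all of them at the same time, independently. -/
def Protocol.parallel {n : ℕ} (P : Protocol n) (m : ℕ) : Protocol (m * n) where
  A := Fin m → P.A
  B := Fin m → P.B
  C := Fin m → P.C
  aliceInit x := tensorState fun i => P.aliceInit (block x i)
  bobInit := tensorState fun _ => P.bobInit
  channelInit := tensorState fun _ => P.channelInit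
  commitRounds := P.commitRounds
  aliceCommit k := unitaryPow m (P.aliceCommit k)
  bobCommit k := unitaryPow m (P.bobCommit k)
  revealRounds := P.revealRounds
  aliceReveal k := unitaryPow m (P.aliceReveal k)
  bobReveal k := unitaryPow m (P.bobReveal k)
  opening := (P.opening.pow m).map jointOutcome

end QBSC

end

/-! The statement follows from a trade-off without additive constant: every QBSC, with either
measure of concealment, has n ≤ a + b. For P^m this reads mn ≤ ma + mb, hence n ≤ a + b. Part 1 then
holds because c > 0, and parts 2 and 3 hold with M = 1; of P^m only the string length mn matters.

Let ρ_x be Bob's state after an honest commitment to x, ρ the average of these states, and T_x = Tr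
√ρ_x √ρ their affinity.

Binding gives ∑ T_x² ≤ 2^a (`sum_affinity_sq_le_of_binding`). Alice commits honestly to a uniform
superposition of all strings, keeping the string in a register, so that Bob holds ρ. To open x she
applies a unitary to her side of this purification of ρ, chosen so that the overlap with an honest
commitment to x becomes T_x. Then she reveals honestly. An opening that is certain on the honest
state is accepted with probability at least the squared overlap.

Concealing gives a bound in the opposite direction. The pretty good measurement guesses x with
probability q_x ≥ 2^{-n} / T_x² (`prob_le_prettyGood_prob_mul`), so q_x T_x² ≥ 2^{-n} for each x,
and Cauchy–Schwarz yields 2^n ≤ (∑ q_x)(∑ T_x²) ≤ 2^b 2^a.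

For the Holevo information, -2 log₂ T_x is at most the relative entropy D(ρ_x‖ρ), whose average over
x is χ. Concavity of the logarithm then gives -χ ≤ log₂(2^{-n} ∑ T_x²) ≤ a - n. -/

noncomputable section

namespace QBSC

open scoped ComplexOrder MatrixOrder

/-! ### Functions of a density matrix -/

namespace DensityMatrix

variable {B : Type} [Fintype B] [DecidableEq B]

/-- The eigenvalues of a density matrix. -/
def eig (ρ : DensityMatrix B) : B → ℝ := ρ.posSemidef.isHermitian.eigenvalues

/-- The unitary whose columns are eigenvectors of a density matrix. -/
def eigU (ρ : DensityMatrix B) : Matrix B B ℂ := ρ.posSemidef.isHermitian.eigenvectorUnitary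

/-- The function `f` applied to the density matrix `ρ`. -/
def specFun (ρ : DensityMatrix B) (f : ℝ → ℝ) : Matrix B B ℂ :=
  ρ.eigU * Matrix.diagonal (fun i => (f (ρ.eig i) : ℂ)) * ρ.eigU.conjTranspose

theorem eig_nonneg (ρ : DensityMatrix B) (i : B) : 0 ≤ ρ.eig i :=
  ρ.posSemidef.eigenvalues_nonneg i

theorem eigU_conjTranspose_mul (ρ : DensityMatrix B) : ρ.eigU.conjTranspose * ρ.eigU = 1 :=
  Matrix.mem_unitaryGroup_iff'.mp ρ.posSemidef.isHermitian.eigenvectorUnitary.2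

theorem eigU_mul_conjTranspose (ρ : DensityMatrix B) : ρ.eigU * ρ.eigU.conjTranspose = 1 :=
  Matrix.mem_unitaryGroup_iff.mp ρ.posSemidef.isHermitian.eigenvectorUnitary.2

theorem specFun_id (ρ : DensityMatrix B) : ρ.specFun id = ρ.mat := by
  have h := ρ.posSemidef.isHermitian.spectral_theorem
  rw [Unitary.conjStarAlgAut_apply] at h
  exact h.symm

theorem specFun_mul (ρ : DensityMatrix B) (f g : ℝ → ℝ) :
    ρ.specFun f * ρ.specFun g = ρ.specFun fun t => f t * g t := by
  have h : ρ.specFun f * ρ.specFun g = ρ.eigU * (Matrix.diagonal (fun i => (f (ρ.eig i) : ℂ)) *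
      ((ρ.eigU.conjTranspose * ρ.eigU) * Matrix.diagonal (fun i => (g (ρ.eig i) : ℂ)))) *
      ρ.eigU.conjTranspose := by
    simp only [specFun, Matrix.mul_assoc]
  rw [h, eigU_conjTranspose_mul, Matrix.one_mul, Matrix.diagonal_mul_diagonal]
  simp [specFun]

theorem specFun_one (ρ : DensityMatrix B) : ρ.specFun (fun _ => 1) = 1 := by
  simp [specFun, eigU_mul_conjTranspose]

theorem specFun_sub (ρ : DensityMatrix B) (f g : ℝ → ℝ) :
    ρ.specFun f - ρ.specFun g = ρ.specFun fun t => f t - g t := by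
  have h : Matrix.diagonal (fun i => ((f (ρ.eig i) - g (ρ.eig i) : ℝ) : ℂ)) =
      Matrix.diagonal (fun i => (f (ρ.eig i) : ℂ)) - Matrix.diagonal fun i => (g (ρ.eig i) : ℂ) := by
    rw [Matrix.diagonal_sub]
    simp
  simp only [specFun]
  rw [h, Matrix.mul_sub, Matrix.sub_mul]

theorem specFun_conjTranspose (ρ : DensityMatrix B) (f : ℝ → ℝ) :
    (ρ.specFun f).conjTranspose = ρ.specFun f := by
  simp only [specFun, Matrix.conjTranspose_mul, Matrix.conjTranspose_conjTranspose,
    Matrix.diagonal_conjTranspose, Matrix.mul_assoc]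
  congr 3
  ext i
  simp

theorem specFun_posSemidef (ρ : DensityMatrix B) {f : ℝ → ℝ} (h : ∀ i, 0 ≤ f (ρ.eig i)) :
    (ρ.specFun f).PosSemidef := by
  refine Matrix.PosSemidef.mul_mul_conjTranspose_same ?_ _
  refine Matrix.PosSemidef.diagonal fun i => ?_
  exact Complex.zero_le_real.mpr (h i)

theorem specFun_congr (ρ : DensityMatrix B) {f g : ℝ → ℝ} (h : ∀ i, f (ρ.eig i) = g (ρ.eig i)) :
    ρ.specFun f = ρ.specFun g := by
  simp only [specFun, h]

theorem specFun_sqrt_mul_self (ρ : DensityMatrix B) :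
    ρ.specFun Real.sqrt * ρ.specFun Real.sqrt = ρ.mat := by
  rw [specFun_mul, ← specFun_id]
  exact specFun_congr _ fun i => Real.mul_self_sqrt (ρ.eig_nonneg i)

/-! ### Eigenbasis overlaps, affinity, and its two lower bounds -/

/-- The squared overlap of two eigenvectors of two density matrices. -/
def overlap (ρ σ : DensityMatrix B) (i j : B) : ℝ :=
  ‖(ρ.eigU.conjTranspose * σ.eigU) i j‖ ^ 2

theorem overlap_nonneg (ρ σ : DensityMatrix B) (i j : B) : 0 ≤ ρ.overlap σ i j := sq_nonneg _

theorem overlap_comm (ρ σ : DensityMatrix B) (i j : B) : ρ.overlap σ i j = σ.overlap ρ j i := by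
  unfold overlap
  rw [← norm_star, ← Matrix.conjTranspose_apply, Matrix.conjTranspose_mul,
    Matrix.conjTranspose_conjTranspose]

/-- The overlaps are squared moduli of the entries of a unitary. Hence `ρ.eig i * ρ.overlap σ i j`
is a classical joint distribution, and quantities of two noncommuting states become double sums to
which scalar inequalities apply. -/
theorem sum_overlap (ρ σ : DensityMatrix B) (i : B) : ∑ j, ρ.overlap σ i j = 1 := by
  have h : (ρ.eigU.conjTranspose * σ.eigU) * (ρ.eigU.conjTranspose * σ.eigU).conjTranspose = 1 := by
    rw [Matrix.conjTranspose_mul, Matrix.conjTranspose_conjTranspose, Matrix.mul_assoc,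
      ← Matrix.mul_assoc σ.eigU, eigU_mul_conjTranspose, Matrix.one_mul, eigU_conjTranspose_mul]
  have h' := congrFun (congrFun h i) i
  rw [Matrix.mul_apply] at h'
  simp only [Matrix.conjTranspose_apply, RCLike.star_def, Complex.mul_conj', Matrix.one_apply_eq]
    at h'
  exact_mod_cast h'

/-- A function of `σ` in an eigenvector of `ρ`. -/
theorem conj_specFun_diag (ρ σ : DensityMatrix B) (g : ℝ → ℝ) (i : B) :
    (ρ.eigU.conjTranspose * σ.specFun g * ρ.eigU) i i =
      ((∑ j, g (σ.eig j) * ρ.overlap σ i j : ℝ) : ℂ) := by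
  have h : ρ.eigU.conjTranspose * σ.specFun g * ρ.eigU =
      (ρ.eigU.conjTranspose * σ.eigU) * Matrix.diagonal (fun j => (g (σ.eig j) : ℂ)) *
        (ρ.eigU.conjTranspose * σ.eigU).conjTranspose := by
    simp only [specFun, Matrix.conjTranspose_mul, Matrix.conjTranspose_conjTranspose,
      Matrix.mul_assoc]
  rw [h, Matrix.mul_apply]
  simp only [Matrix.mul_diagonal, Matrix.conjTranspose_apply, RCLike.star_def]
  push_cast
  refine Finset.sum_congr rfl fun j _ => ?_
  rw [overlap, Complex.ofReal_pow, ← Complex.mul_conj']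
  ring

theorem trace_specFun_mul (ρ σ : DensityMatrix B) (f g : ℝ → ℝ) :
    (ρ.specFun f * σ.specFun g).trace =
      ((∑ i, ∑ j, f (ρ.eig i) * g (σ.eig j) * ρ.overlap σ i j : ℝ) : ℂ) := by
  have h : (ρ.specFun f * σ.specFun g).trace =
      (Matrix.diagonal (fun i => (f (ρ.eig i) : ℂ)) *
        (ρ.eigU.conjTranspose * σ.specFun g * ρ.eigU)).trace := by
    rw [specFun, Matrix.mul_assoc, Matrix.mul_assoc, Matrix.trace_mul_comm]
    simp only [Matrix.mul_assoc]
  rw [h, Matrix.trace]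
  simp only [Matrix.diag_apply, Matrix.diagonal_mul, conj_specFun_diag]
  push_cast
  refine Finset.sum_congr rfl fun i _ => ?_
  rw [Finset.mul_sum]
  exact Finset.sum_congr rfl fun j _ => by ring

theorem sum_eig (ρ : DensityMatrix B) : ∑ i, ρ.eig i = 1 := by
  have h := ρ.posSemidef.isHermitian.trace_eq_sum_eigenvalues
  rw [ρ.trace_eq_one] at h
  have h' : ((∑ i, ρ.eig i : ℝ) : ℂ) = 1 := by
    rw [h]
    push_cast
    rfl
  exact_mod_cast h'

theorem entropy_eq (ρ : DensityMatrix B) :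
    ρ.entropy = -(∑ i, ρ.eig i * Real.log (ρ.eig i)) / Real.log 2 := by
  simp only [entropy, Real.negMulLog, neg_mul, Finset.sum_neg_distrib]
  rfl

/-- The affinity `Tr √ρ √σ`. -/
def affinity (ρ σ : DensityMatrix B) : ℝ :=
  ∑ i, ∑ j, √(ρ.eig i) * √(σ.eig j) * ρ.overlap σ i j

theorem trace_sqrt_mul_sqrt (ρ σ : DensityMatrix B) :
    (ρ.specFun Real.sqrt * σ.specFun Real.sqrt).trace = (ρ.affinity σ : ℂ) :=
  trace_specFun_mul ρ σ _ _

theorem affinity_nonneg (ρ σ : DensityMatrix B) : 0 ≤ ρ.affinity σ :=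
  Finset.sum_nonneg fun _ _ => Finset.sum_nonneg fun _ _ =>
    mul_nonneg (mul_nonneg (Real.sqrt_nonneg _) (Real.sqrt_nonneg _)) (overlap_nonneg _ _ _ _)

/-- The support of `ρ` is contained in the support of `σ`. -/
def SuppLE (ρ σ : DensityMatrix B) : Prop :=
  ∀ i j, σ.eig j = 0 → ρ.eig i * ρ.overlap σ i j = 0

/-- In a null eigenvector of σ the diagonal entry of cσ - ρ is minus a sum of nonnegative terms, yet
it is nonnegative; so every term vanishes. -/
theorem suppLE_of_smul_le {ρ σ : DensityMatrix B} {c : ℝ}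
    (h : ((c : ℂ) • σ.mat - ρ.mat).PosSemidef) : ρ.SuppLE σ := by
  intro i j hj
  have h1 : ∀ τ : DensityMatrix B, (σ.eigU.conjTranspose * τ.mat * σ.eigU) j j =
      ((∑ i, τ.eig i * σ.overlap τ j i : ℝ) : ℂ) := fun τ => by
    rw [← τ.specFun_id, conj_specFun_diag]; rfl
  have h2 : 0 ≤ (σ.eigU.conjTranspose * ((c : ℂ) • σ.mat - ρ.mat) * σ.eigU) j j :=
    (h.conjTranspose_mul_mul_same σ.eigU).diag_nonneg
  have h3 : (σ.eigU.conjTranspose * σ.mat * σ.eigU) j j = 0 := by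
    have e : σ.eigU.conjTranspose * σ.specFun id * σ.eigU =
        (σ.eigU.conjTranspose * σ.eigU) * Matrix.diagonal (fun i => (σ.eig i : ℂ)) *
          (σ.eigU.conjTranspose * σ.eigU) := by
      simp only [specFun, Matrix.mul_assoc, id]
    rw [← σ.specFun_id, e, eigU_conjTranspose_mul, Matrix.one_mul, Matrix.mul_one,
      Matrix.diagonal_apply_eq, hj]
    simp
  rw [Matrix.mul_sub, Matrix.sub_mul, Matrix.sub_apply, Matrix.mul_smul, Matrix.smul_mul,
    Matrix.smul_apply, h3, h1 ρ, smul_zero, zero_sub, ← Complex.ofReal_neg] at h2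
  have h4 : ∑ i, ρ.eig i * σ.overlap ρ j i ≤ 0 := by
    have : (0 : ℝ) ≤ -∑ i, ρ.eig i * σ.overlap ρ j i := by exact_mod_cast h2
    linarith
  have h5 : ∀ i ∈ Finset.univ, 0 ≤ ρ.eig i * σ.overlap ρ j i := fun i _ =>
    mul_nonneg (ρ.eig_nonneg i) (overlap_nonneg _ _ _ _)
  have h6 := (Finset.sum_eq_zero_iff_of_nonneg h5).mp (le_antisymm h4 (Finset.sum_nonneg h5))
  rw [overlap_comm]
  exact h6 i (Finset.mem_univ i)

theorem sum_eig_mul_overlap (ρ σ : DensityMatrix B) :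
    ∑ i, ∑ j, ρ.eig i * ρ.overlap σ i j = 1 := by
  simp only [← Finset.mul_sum, sum_overlap, mul_one, sum_eig]

theorem affinity_pos {ρ σ : DensityMatrix B} (h : ρ.SuppLE σ) : 0 < ρ.affinity σ := by
  refine (affinity_nonneg ρ σ).lt_of_ne fun h0 => ?_
  have hn : ∀ i j, 0 ≤ √(ρ.eig i) * √(σ.eig j) * ρ.overlap σ i j := fun i j =>
    mul_nonneg (mul_nonneg (Real.sqrt_nonneg _) (Real.sqrt_nonneg _)) (overlap_nonneg _ _ _ _)
  have h1 : ∀ i j, √(ρ.eig i) * √(σ.eig j) * ρ.overlap σ i j = 0 := fun i j => by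
    have a := (Finset.sum_eq_zero_iff_of_nonneg fun i _ =>
      Finset.sum_nonneg fun j _ => hn i j).mp h0.symm i (Finset.mem_univ i)
    exact (Finset.sum_eq_zero_iff_of_nonneg fun j _ => hn i j).mp a j (Finset.mem_univ j)
  have h2 : ∀ i j, ρ.eig i * ρ.overlap σ i j = 0 := fun i j => by
    rcases mul_eq_zero.mp (h1 i j) with h' | h'
    · rcases mul_eq_zero.mp h' with h' | h'
      · rw [(Real.sqrt_eq_zero (ρ.eig_nonneg i)).mp h', zero_mul]
      · exact h i j ((Real.sqrt_eq_zero (σ.eig_nonneg j)).mp h')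
    · rw [h', mul_zero]
  have h3 := sum_eig_mul_overlap ρ σ
  simp [h2] at h3

/-- The affinity is at least `exp (-D(ρ‖σ)/2)`. -/
theorem two_mul_log_affinity_ge {ρ σ : DensityMatrix B} (h : ρ.SuppLE σ) :
    ∑ i, ∑ j, ρ.eig i * ρ.overlap σ i j * (Real.log (σ.eig j) - Real.log (ρ.eig i)) ≤
      2 * Real.log (ρ.affinity σ) := by
  set T := ρ.affinity σ with hT
  have hpos : 0 < T := affinity_pos h
  -- Jensen for the logarithm, term by term: log t ≤ t - 1 at t = √(σ_j / ρ_i) / T. Under the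
  -- weights `ρ.eig i * ρ.overlap σ i j` the mean of √(σ_j / ρ_i) is T, so the right-hand sides sum
  -- to 0.
  have key : ∀ i j, ρ.eig i * ρ.overlap σ i j *
      ((Real.log (σ.eig j) - Real.log (ρ.eig i)) / 2 - Real.log T) ≤
      √(ρ.eig i) * √(σ.eig j) * ρ.overlap σ i j / T - ρ.eig i * ρ.overlap σ i j := by
    intro i j
    by_cases h0 : ρ.eig i * ρ.overlap σ i j = 0
    · rw [h0, zero_mul, sub_zero]
      exact div_nonneg (mul_nonneg (mul_nonneg (Real.sqrt_nonneg _) (Real.sqrt_nonneg _))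
        (overlap_nonneg _ _ _ _)) hpos.le
    · have hp : 0 < ρ.eig i := (ρ.eig_nonneg i).lt_of_ne fun e => h0 (by rw [← e, zero_mul])
      have hq : 0 < σ.eig j := (σ.eig_nonneg j).lt_of_ne fun e => h0 (h i j e.symm)
      have hsp := Real.sqrt_pos.mpr hp
      have hsq := Real.sqrt_pos.mpr hq
      have hl := Real.log_le_sub_one_of_pos (div_pos (div_pos hsq hsp) hpos)
      rw [Real.log_div (div_pos hsq hsp).ne' hpos.ne', Real.log_div hsq.ne' hsp.ne',
        Real.log_sqrt hq.le, Real.log_sqrt hp.le] at hl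
      have hc : 0 ≤ ρ.eig i * ρ.overlap σ i j := mul_nonneg hp.le (overlap_nonneg _ _ _ _)
      have hm := mul_le_mul_of_nonneg_left hl hc
      have e : ρ.eig i * ρ.overlap σ i j * (√(σ.eig j) / √(ρ.eig i) / T - 1) =
          √(ρ.eig i) * √(σ.eig j) * ρ.overlap σ i j / T - ρ.eig i * ρ.overlap σ i j := by
        have gen : ∀ a b c : ℝ, 0 < a → a ^ 2 * c * (b / a / T - 1) = a * b * c / T - a ^ 2 * c := by
          intro a b c ha
          field_simp
        have := gen √(ρ.eig i) √(σ.eig j) (ρ.overlap σ i j) hsp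
        rwa [Real.sq_sqrt hp.le] at this
      rw [e] at hm
      refine le_trans (le_of_eq ?_) hm
      ring
  have hs := Finset.sum_le_sum fun i (_ : i ∈ Finset.univ) =>
    Finset.sum_le_sum fun j (_ : j ∈ Finset.univ) => key i j
  simp only [mul_sub, Finset.sum_sub_distrib, ← Finset.sum_div, ← Finset.sum_mul,
    sum_eig_mul_overlap] at hs
  have e2 : (∑ i, ∑ j, √(ρ.eig i) * √(σ.eig j) * ρ.overlap σ i j) / T = 1 := by
    rw [hT, affinity, div_self]
    exact hpos.ne'
  rw [e2] at hs
  have e3 : ∑ i, ∑ j, ρ.eig i * ρ.overlap σ i j * ((Real.log (σ.eig j) - Real.log (ρ.eig i)) / 2) =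
      (∑ i, ∑ j, ρ.eig i * ρ.overlap σ i j * (Real.log (σ.eig j) - Real.log (ρ.eig i))) / 2 := by
    simp only [Finset.sum_div, mul_div_assoc]
  rw [e3] at hs
  linarith

/-- The collision quantity `Tr σ^{-1/2} ρ σ^{-1/2} ρ` is at least `(Tr √ρ √σ)^{-2}`. -/
theorem one_le_collision_mul_affinity_sq {ρ σ : DensityMatrix B} (h : ρ.SuppLE σ) :
    1 ≤ (σ.specFun (fun t => (√t)⁻¹) * ρ.mat * σ.specFun (fun t => (√t)⁻¹) * ρ.mat).trace.re *
      ρ.affinity σ ^ 2 := by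
  set τ := σ.specFun fun t => (√t)⁻¹ with hτ
  set K := ρ.eigU.conjTranspose * τ * ρ.eigU with hK
  set s : B → ℝ := fun i => ∑ j, √(σ.eig j) * ρ.overlap σ i j with hs
  set r : B → ℝ := fun i => ∑ j, (√(σ.eig j))⁻¹ * ρ.overlap σ i j with hr
  set T := ρ.affinity σ with hT
  have hT' : T = ∑ i, √(ρ.eig i) * s i := by
    simp only [hT, affinity, hs, Finset.mul_sum, mul_assoc]
  have hpos : 0 < T := affinity_pos h
  have hKii : ∀ i, K i i = (r i : ℂ) := fun i => conj_specFun_diag ρ σ _ i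
  have hKh : K.conjTranspose = K := by
    rw [hK, Matrix.conjTranspose_mul, Matrix.conjTranspose_mul, hτ, specFun_conjTranspose,
      Matrix.conjTranspose_conjTranspose, Matrix.mul_assoc]
  have h1 : (τ * ρ.mat * τ * ρ.mat).trace.re = ∑ i, ∑ j, ρ.eig i * ρ.eig j * ‖K i j‖ ^ 2 := by
    have e : (τ * ρ.mat * τ * ρ.mat).trace =
        (K * Matrix.diagonal (fun i => (ρ.eig i : ℂ)) *
          (K * Matrix.diagonal (fun i => (ρ.eig i : ℂ)))).trace := by
      rw [← ρ.specFun_id]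
      simp only [specFun, hK, id]
      simp only [← Matrix.mul_assoc]
      rw [Matrix.trace_mul_comm]
      simp only [← Matrix.mul_assoc]
    rw [e, Matrix.trace, Complex.re_sum]
    refine Finset.sum_congr rfl fun i _ => ?_
    rw [Matrix.diag_apply, Matrix.mul_apply, Complex.re_sum]
    refine Finset.sum_congr rfl fun j _ => ?_
    have e2 : K j i = star (K i j) := by
      rw [← Matrix.conjTranspose_apply, hKh]
    rw [Matrix.mul_diagonal, Matrix.mul_diagonal, e2, RCLike.star_def]
    have e3 : K i j * (ρ.eig j : ℂ) * ((starRingEnd ℂ) (K i j) * (ρ.eig i : ℂ)) =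
        ((ρ.eig i * ρ.eig j * ‖K i j‖ ^ 2 : ℝ) : ℂ) := by
      push_cast
      rw [← Complex.mul_conj']
      ring
    rw [e3, Complex.ofReal_re]
  -- All terms of the double sum are nonnegative; only the diagonal ones are kept.
  have h2 : ∑ i, ρ.eig i ^ 2 * r i ^ 2 ≤ (τ * ρ.mat * τ * ρ.mat).trace.re := by
    rw [h1]
    refine Finset.sum_le_sum fun i _ => ?_
    have e : ρ.eig i ^ 2 * r i ^ 2 = ρ.eig i * ρ.eig i * ‖K i i‖ ^ 2 := by
      rw [hKii, Complex.norm_real, Real.norm_eq_abs, sq_abs]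
      ring
    rw [e]
    exact Finset.single_le_sum (f := fun j => ρ.eig i * ρ.eig j * ‖K i j‖ ^ 2)
      (fun j _ => mul_nonneg (mul_nonneg (ρ.eig_nonneg i) (ρ.eig_nonneg j)) (sq_nonneg _))
      (Finset.mem_univ i)
  -- Cauchy–Schwarz for √σ_j against its inverse, weighted by the overlaps, which sum to 1. Where
  -- σ_j = 0 the convention 0⁻¹ = 0 does no harm, since the support condition makes the weight
  -- vanish.
  have h3 : ∀ i, 0 < ρ.eig i → 1 ≤ s i * r i := by
    intro i hi
    have cs := Finset.sum_sq_le_sum_mul_sum_of_sq_le_mul Finset.univ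
      (r := fun j => ρ.overlap σ i j) (f := fun j => √(σ.eig j) * ρ.overlap σ i j)
      (g := fun j => (√(σ.eig j))⁻¹ * ρ.overlap σ i j)
      (fun j _ => mul_nonneg (Real.sqrt_nonneg _) (overlap_nonneg _ _ _ _))
      (fun j _ => mul_nonneg (inv_nonneg.mpr (Real.sqrt_nonneg _)) (overlap_nonneg _ _ _ _))
      (fun j _ => by
        rcases (σ.eig_nonneg j).eq_or_lt with h0 | h0
        · have := (mul_eq_zero.mp (h i j h0.symm)).resolve_left hi.ne'
          simp [this]
        · have := Real.sqrt_pos.mpr h0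
          apply le_of_eq
          field_simp)
    simpa [sum_overlap] using cs
  have hsn : ∀ i, 0 ≤ s i := fun i => Finset.sum_nonneg fun j _ =>
    mul_nonneg (Real.sqrt_nonneg _) (overlap_nonneg _ _ _ _)
  -- Jensen for the convex function u ↦ u⁻² with weights ρ_i, at u_i = s_i / √ρ_i whose mean is T.
  -- The tangent at u = T is 3/T² - 2u/T³, and its mean is 1/T².
  have h4 : ∀ i, ρ.eig i * 3 / T ^ 2 - 2 * (√(ρ.eig i) * s i) / T ^ 3 ≤
      ρ.eig i ^ 2 * r i ^ 2 := by
    intro i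
    rcases (ρ.eig_nonneg i).eq_or_lt with h0 | h0
    · simp [← h0]
    · have hsr := h3 i h0
      have hs0 : 0 < s i := (hsn i).lt_of_ne fun e => by rw [← e] at hsr; linarith
      have hsp := Real.sqrt_pos.mpr h0
      set u := s i / √(ρ.eig i) with hu
      have hu0 : 0 < u := div_pos hs0 hsp
      have hsu : s i = √(ρ.eig i) * u := by rw [hu]; field_simp
      have hr1 : (s i)⁻¹ ≤ r i := by
        rw [inv_le_iff_one_le_mul₀' hs0]; exact hsr
      have hr2 : ((s i)⁻¹) ^ 2 ≤ r i ^ 2 := pow_le_pow_left₀ (inv_nonneg.mpr hs0.le) hr1 2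
      have hpp : √(ρ.eig i) ^ 2 = ρ.eig i := Real.sq_sqrt h0.le
      have e1 : ρ.eig i ^ 2 * ((s i)⁻¹) ^ 2 = ρ.eig i * (u⁻¹) ^ 2 := by
        rw [hsu, mul_inv, mul_pow, inv_pow, hpp]
        field_simp
      have e2 : √(ρ.eig i) * s i = ρ.eig i * u := by
        rw [hsu, ← mul_assoc, ← sq, hpp]
      have tangent : 3 / T ^ 2 - 2 * u / T ^ 3 ≤ (u⁻¹) ^ 2 := by
        rw [← sub_nonneg]
        have : (u⁻¹) ^ 2 - (3 / T ^ 2 - 2 * u / T ^ 3) =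
            (u - T) ^ 2 * (2 * u + T) / (u ^ 2 * T ^ 3) := by
          field_simp
          ring
        rw [this]
        positivity
      calc ρ.eig i * 3 / T ^ 2 - 2 * (√(ρ.eig i) * s i) / T ^ 3
          = ρ.eig i * (3 / T ^ 2 - 2 * u / T ^ 3) := by rw [e2]; ring
        _ ≤ ρ.eig i * (u⁻¹) ^ 2 := mul_le_mul_of_nonneg_left tangent h0.le
        _ = ρ.eig i ^ 2 * ((s i)⁻¹) ^ 2 := e1.symm
        _ ≤ ρ.eig i ^ 2 * r i ^ 2 := mul_le_mul_of_nonneg_left hr2 (sq_nonneg _)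
  have h5 := Finset.sum_le_sum fun i (_ : i ∈ Finset.univ) => h4 i
  rw [Finset.sum_sub_distrib] at h5
  simp only [← Finset.sum_div, ← Finset.sum_mul, ← Finset.mul_sum, sum_eig, ← hT'] at h5
  have h6 : 1 / T ^ 2 ≤ (τ * ρ.mat * τ * ρ.mat).trace.re := by
    refine le_trans (le_of_eq ?_) (h5.trans h2)
    field_simp
    ring
  rwa [div_le_iff₀ (by positivity)] at h6

end DensityMatrix

/-! ### Unitary freedom of purifications -/

/-- Equality of the Gram operators says that G†x and H†x have the same norm for all x. So G†x ↦ H†x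
is a well-defined isometry on the range of G†, which extends to a unitary of the whole
finite-dimensional space. -/
theorem exists_unitary_mul_eq {B T : Type} [Fintype B] [Fintype T] [DecidableEq B] [DecidableEq T]
    (G H : Matrix B T ℂ) (h : G * G.conjTranspose = H * H.conjTranspose) :
    ∃ W ∈ Matrix.unitaryGroup T ℂ, G * W = H := by
  let f := Matrix.toEuclideanLin G.conjTranspose
  let g := Matrix.toEuclideanLin H.conjTranspose
  have hnorm : ∀ x, ‖f x‖ = ‖g x‖ := by
    have key : ∀ (M : Matrix B T ℂ) (x : EuclideanSpace ℂ B),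
        inner ℂ (Matrix.toEuclideanLin M.conjTranspose x) (Matrix.toEuclideanLin M.conjTranspose x) =
          inner ℂ x (Matrix.toEuclideanLin (M * M.conjTranspose) x) := by
      intro M x
      rw [Matrix.toEuclideanLin_conjTranspose_eq_adjoint, LinearMap.adjoint_inner_left,
        ← Matrix.toEuclideanLin_conjTranspose_eq_adjoint]
      congr 1
      simp [Matrix.toLpLin_apply, Matrix.mulVec_mulVec]
    intro x
    have e := (key G x).trans ((congrArg (fun M => inner ℂ x (Matrix.toEuclideanLin M x)) h).trans
      (key H x).symm)
    rw [inner_self_eq_norm_sq_to_K, inner_self_eq_norm_sq_to_K] at e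
    have e' : ‖f x‖ ^ 2 = ‖g x‖ ^ 2 := by exact_mod_cast e
    exact (sq_eq_sq₀ (norm_nonneg _) (norm_nonneg _)).mp e'
  obtain ⟨s, hs⟩ := f.rangeRestrict.exists_rightInverse_of_surjective f.range_rangeRestrict
  have hs' : ∀ y, f (s y) = y := fun y =>
    congrArg Subtype.val (LinearMap.congr_fun hs y)
  -- The map is defined through a linear section `s` of f; independence of the chosen preimage is
  -- checked in `hM` from equality of norms.
  let L : LinearMap.range f →ₗᵢ[ℂ] EuclideanSpace ℂ T :=
    { toLinearMap := g ∘ₗ s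
      norm_map' := fun y => by
        change ‖g (s y)‖ = ‖y‖
        rw [← hnorm, hs']
        rfl }
  let M := L.extend
  have hM : ∀ x, M (f x) = g x := by
    intro x
    have e1 : M (f x) = g (s ⟨f x, LinearMap.mem_range_self f x⟩) :=
      L.extend_apply ⟨f x, LinearMap.mem_range_self f x⟩
    rw [e1, ← sub_eq_zero, ← map_sub, ← norm_eq_zero, ← hnorm, map_sub, hs', sub_self, norm_zero]
  let N : EuclideanSpace ℂ T ≃ₗᵢ[ℂ] EuclideanSpace ℂ T := M.toLinearIsometryEquiv rfl
  let b := EuclideanSpace.basisFun T ℂ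
  let V : Matrix T T ℂ := N.toLinearEquiv.toLinearMap.toMatrix b.toBasis b.toBasis
  have hV : V ∈ Matrix.unitaryGroup T ℂ := N.toMatrix_mem_unitaryGroup b b
  have hVG : V * G.conjTranspose = H.conjTranspose := by
    apply Matrix.toEuclideanLin.injective
    refine LinearMap.ext fun x => ?_
    have e2 : Matrix.toEuclideanLin V = N.toLinearEquiv.toLinearMap := by
      rw [Matrix.toEuclideanLin_eq_toLin_orthonormal]
      exact Matrix.toLin_toMatrix _ _ _
    have e3 : Matrix.toEuclideanLin (V * G.conjTranspose) x = Matrix.toEuclideanLin V (f x) := by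
      simp [f, Matrix.toLpLin_apply, Matrix.mulVec_mulVec]
    rw [e3, e2]
    exact hM x
  refine ⟨star V, Unitary.star_mem hV, ?_⟩
  have := congrArg Matrix.conjTranspose hVG
  simpa [Matrix.conjTranspose_mul, Matrix.star_eq_conjTranspose] using this

/-- Both purifications can be rotated to the canonical ones √ρ J and √σ J, with J a coisometry,
whose overlap is Tr √ρ √σ. The embedding `e` supplies J: the purifying space must be at least as
large as B. -/
theorem exists_unitary_trace_eq_affinity {B T : Type} [Fintype B] [Fintype T] [DecidableEq B]
    [DecidableEq T] (ρ σ : DensityMatrix B) (G H : Matrix B T ℂ) (e : B ↪ T)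
    (hG : G * G.conjTranspose = ρ.mat) (hH : H * H.conjTranspose = σ.mat) :
    ∃ W ∈ Matrix.unitaryGroup T ℂ, (G * W * H.conjTranspose).trace = (ρ.affinity σ : ℂ) := by
  let J : Matrix B T ℂ := Matrix.of fun b t => if e b = t then 1 else 0
  have hJ : J * J.conjTranspose = 1 := by
    ext b b'
    simp [J, Matrix.mul_apply, Matrix.one_apply, eq_comm]
  have hp : ∀ τ : DensityMatrix B,
      τ.specFun Real.sqrt * J * (τ.specFun Real.sqrt * J).conjTranspose = τ.mat := by
    intro τ
    rw [Matrix.conjTranspose_mul, Matrix.mul_assoc, ← Matrix.mul_assoc J, hJ, Matrix.one_mul,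
      τ.specFun_conjTranspose, τ.specFun_sqrt_mul_self]
  obtain ⟨W₁, hW₁, h₁⟩ := exists_unitary_mul_eq G _ (hG.trans (hp ρ).symm)
  obtain ⟨W₂, hW₂, h₂⟩ := exists_unitary_mul_eq H _ (hH.trans (hp σ).symm)
  refine ⟨W₁ * star W₂, mul_mem hW₁ (Unitary.star_mem hW₂), ?_⟩
  have : G * (W₁ * star W₂) * H.conjTranspose =
      ρ.specFun Real.sqrt * σ.specFun Real.sqrt := by
    calc G * (W₁ * star W₂) * H.conjTranspose = (G * W₁) * (H * W₂).conjTranspose := by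
          simp only [Matrix.conjTranspose_mul, Matrix.star_eq_conjTranspose, Matrix.mul_assoc]
      _ = ρ.specFun Real.sqrt * (J * J.conjTranspose) * σ.specFun Real.sqrt := by
          rw [h₁, h₂, Matrix.conjTranspose_mul, σ.specFun_conjTranspose]
          simp only [Matrix.mul_assoc]
      _ = _ := by rw [hJ, Matrix.mul_one]
  rw [this, DensityMatrix.trace_sqrt_mul_sqrt]

/-! ### Effects -/

theorem trace_conjTranspose_mul_self_re {B T : Type} [Fintype B] [Fintype T] (M : Matrix B T ℂ) :
    (M.conjTranspose * M).trace.re = ∑ t, ∑ b, ‖M b t‖ ^ 2 := by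
  simp only [Matrix.trace, Matrix.diag_apply, Matrix.mul_apply, Matrix.conjTranspose_apply,
    RCLike.star_def, Complex.conj_mul', Complex.re_sum]
  norm_cast

theorem norm_trace_conjTranspose_mul_sq_le {B T : Type} [Fintype B] [Fintype T]
    (M N : Matrix B T ℂ) :
    ‖(M.conjTranspose * N).trace‖ ^ 2 ≤
      (M.conjTranspose * M).trace.re * (N.conjTranspose * N).trace.re := by
  rw [trace_conjTranspose_mul_self_re, trace_conjTranspose_mul_self_re]
  simp only [← Fintype.sum_prod_type' (f := fun t b => ‖M b t‖ ^ 2),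
    ← Fintype.sum_prod_type' (f := fun t b => ‖N b t‖ ^ 2)]
  refine le_trans ?_ (Finset.sum_mul_sq_le_sq_mul_sq Finset.univ
    (fun p : T × B => ‖M p.2 p.1‖) (fun p : T × B => ‖N p.2 p.1‖))
  refine pow_le_pow_left₀ (norm_nonneg _) ?_ 2
  simp only [Matrix.trace, Matrix.diag_apply, Matrix.mul_apply, Matrix.conjTranspose_apply]
  rw [← Fintype.sum_prod_type' (f := fun t b => star (M b t) * N b t)]
  refine (norm_sum_le _ _).trans (le_of_eq ?_)
  simp

theorem exists_conjTranspose_mul_self {B : Type} [Fintype B] [DecidableEq B] {E : Matrix B B ℂ}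
    (h : E.PosSemidef) : ∃ S : Matrix B B ℂ, E = S.conjTranspose * S :=
  CStarAlgebra.nonneg_iff_eq_star_mul_self.mp h.nonneg

theorem trace_mul_re_nonneg {B : Type} [Fintype B] [DecidableEq B] {M N : Matrix B B ℂ}
    (hM : M.PosSemidef) (hN : N.PosSemidef) :
    0 ≤ (M * N).trace.re := by
  obtain ⟨S, hS⟩ := exists_conjTranspose_mul_self hM
  obtain ⟨R, hR⟩ := exists_conjTranspose_mul_self hN
  have e : (M * N).trace = ((S * R.conjTranspose).conjTranspose * (S * R.conjTranspose)).trace := by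
    rw [hS, hR, Matrix.conjTranspose_mul, Matrix.conjTranspose_conjTranspose, ← Matrix.mul_assoc,
      Matrix.trace_mul_comm]
    simp only [Matrix.mul_assoc]
  rw [e, trace_conjTranspose_mul_self_re]
  exact Finset.sum_nonneg fun _ _ => Finset.sum_nonneg fun _ _ => sq_nonneg _

/-- An effect that is certain on one purified state is at least as probable on another one as the
squared overlap of the two. -/
theorem norm_trace_sq_le_effect {B T : Type} [Fintype B] [Fintype T] [DecidableEq B]
    {E : Matrix B B ℂ} (h0 : E.PosSemidef) (h1 : (1 - E).PosSemidef) (G H : Matrix B T ℂ)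
    (hH : (H * H.conjTranspose).trace = 1) (hE : (E * (H * H.conjTranspose)).trace.re = 1) :
    ‖(G * H.conjTranspose).trace‖ ^ 2 ≤ (E * (G * G.conjTranspose)).trace.re := by
  obtain ⟨S, hS⟩ := exists_conjTranspose_mul_self h0
  obtain ⟨R, hR⟩ := exists_conjTranspose_mul_self h1
  have hq : ∀ Q K : Matrix B B ℂ, ∀ M N : Matrix B T ℂ,
      (Q.conjTranspose * K * (M * N.conjTranspose)).trace =
        ((Q * N).conjTranspose * (K * M)).trace := by
    intro Q K M N
    rw [← Matrix.mul_assoc, Matrix.trace_mul_comm, Matrix.conjTranspose_mul]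
    simp only [Matrix.mul_assoc]
  -- Certainty of E on the state H means that √(1 - E), up to a unitary, annihilates H. Hence E may
  -- be inserted into the overlap of G and H before Cauchy–Schwarz.
  have hRH : R * H = 0 := by
    have e : ((R * H).conjTranspose * (R * H)).trace.re = 0 := by
      rw [← hq, ← hR, Matrix.sub_mul, Matrix.one_mul, Matrix.trace_sub, Complex.sub_re, hH, hE]
      simp
    rw [trace_conjTranspose_mul_self_re] at e
    ext b t
    have e1 := (Finset.sum_eq_zero_iff_of_nonneg fun t _ =>
      Finset.sum_nonneg fun b _ => sq_nonneg _).mp e t (Finset.mem_univ t)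
    have e2 := (Finset.sum_eq_zero_iff_of_nonneg fun b _ => sq_nonneg _).mp e1 b
      (Finset.mem_univ b)
    simpa using e2
  have h2 : (G * H.conjTranspose).trace = ((S * H).conjTranspose * (S * G)).trace := by
    have e : (G * H.conjTranspose).trace = ((E + (1 - E)) * (G * H.conjTranspose)).trace := by
      rw [add_sub_cancel, Matrix.one_mul]
    rw [e, Matrix.add_mul, Matrix.trace_add, hR, hq, hRH, hS, hq]
    simp
  rw [h2]
  refine (norm_trace_conjTranspose_mul_sq_le _ _).trans (le_of_eq ?_)
  rw [← hq, ← hq, ← hS, hE, one_mul]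

theorem POVM.one_sub_effect_posSemidef {ι B : Type} [Fintype ι] [Fintype B] [DecidableEq B]
    (M : POVM ι B) (i : ι) : (1 - M.effect i).PosSemidef := by
  classical
  rw [← M.sum_eq_one, ← Finset.add_sum_erase _ _ (Finset.mem_univ i), add_sub_cancel_left]
  exact Matrix.posSemidef_sum _ fun j _ => M.posSemidef j

/-! ### The average state of an ensemble -/

namespace Ensemble

variable {X B : Type} [Fintype X] [Fintype B]

theorem prob_smul_state_posSemidef (E : Ensemble X B) (x : X) :
    ((E.prob x : ℂ) • (E.state x).mat).PosSemidef :=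
  (E.state x).posSemidef.smul (Complex.zero_le_real.mpr (E.prob_nonneg x))

variable [DecidableEq B]

/-- One summand is dominated by the whole: p_x ρ_x ≤ ρ, so ρ_x ≤ p_x⁻¹ ρ. -/
theorem suppLE_average (E : Ensemble X B) {x : X} (hx : 0 < E.prob x) :
    (E.state x).SuppLE E.average := by
  classical
  refine DensityMatrix.suppLE_of_smul_le (c := (E.prob x)⁻¹) ?_
  have e : ((((E.prob x)⁻¹ : ℝ) : ℂ)) • E.average.mat - (E.state x).mat =
      (((E.prob x)⁻¹ : ℝ) : ℂ) • ∑ y ∈ Finset.univ.erase x, (E.prob y : ℂ) • (E.state y).mat := by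
    change _ • (∑ y, (E.prob y : ℂ) • (E.state y).mat) - _ = _
    rw [← Finset.add_sum_erase _ _ (Finset.mem_univ x), smul_add, smul_smul, ← Complex.ofReal_mul,
      inv_mul_cancel₀ hx.ne']
    simp
  rw [e]
  exact (Matrix.posSemidef_sum _ fun y _ => E.prob_smul_state_posSemidef y).smul
    (Complex.zero_le_real.mpr (inv_nonneg.mpr hx.le))

/-- Both sides are the diagonal of the average state in its own eigenbasis. This turns the averaged
cross terms Tr ρ_x log ρ into Tr ρ log ρ, so that the mean relative entropy to ρ is the Holevo
information. -/
theorem average_eig (E : Ensemble X B) (j : B) :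
    E.average.eig j =
      ∑ x, E.prob x * ∑ i, (E.state x).eig i * (E.state x).overlap E.average i j := by
  have h1 : ∀ τ : DensityMatrix B,
      (E.average.eigU.conjTranspose * τ.mat * E.average.eigU) j j =
        ((∑ i, τ.eig i * E.average.overlap τ j i : ℝ) : ℂ) := fun τ => by
    rw [← τ.specFun_id, DensityMatrix.conj_specFun_diag]; rfl
  have h2 : (E.average.eigU.conjTranspose * E.average.mat * E.average.eigU) j j =
      (E.average.eig j : ℂ) := by
    have e : E.average.eigU.conjTranspose * E.average.specFun id * E.average.eigU =
        (E.average.eigU.conjTranspose * E.average.eigU) *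
          Matrix.diagonal (fun i => (E.average.eig i : ℂ)) *
          (E.average.eigU.conjTranspose * E.average.eigU) := by
      simp only [DensityMatrix.specFun, Matrix.mul_assoc, id]
    rw [← E.average.specFun_id, e, DensityMatrix.eigU_conjTranspose_mul, Matrix.one_mul,
      Matrix.mul_one, Matrix.diagonal_apply_eq]
  have h3 : (E.average.eigU.conjTranspose * E.average.mat * E.average.eigU) j j =
      ((∑ x, E.prob x * ∑ i, (E.state x).eig i * E.average.overlap (E.state x) j i : ℝ) : ℂ) := by
    have e : E.average.eigU.conjTranspose * E.average.mat * E.average.eigU =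
        ∑ x, (E.prob x : ℂ) •
          (E.average.eigU.conjTranspose * (E.state x).mat * E.average.eigU) := by
      change E.average.eigU.conjTranspose * (∑ x, (E.prob x : ℂ) • (E.state x).mat) * _ = _
      simp only [Matrix.mul_sum, Matrix.sum_mul, Matrix.mul_smul, Matrix.smul_mul]
    rw [e, Matrix.sum_apply]
    simp only [Matrix.smul_apply, h1, smul_eq_mul]
    push_cast
    rfl
  rw [h2] at h3
  simp only [DensityMatrix.overlap_comm _ E.average]
  exact_mod_cast h3

/-- The average of `-2 log₂ Tr √ρ_x √ρ` is at most the Holevo information. -/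
theorem neg_holevo_le_sum_log_affinity (E : Ensemble X B) (h : ∀ x, 0 < E.prob x) :
    -(E.holevo * Real.log 2) ≤
      ∑ x, E.prob x * (2 * Real.log ((E.state x).affinity E.average)) := by
  have hl : Real.log 2 ≠ 0 := (Real.log_pos one_lt_two).ne'
  have h1 := Finset.sum_le_sum fun x (_ : x ∈ Finset.univ) => mul_le_mul_of_nonneg_left
    (DensityMatrix.two_mul_log_affinity_ge (E.suppLE_average (h x))) (E.prob_nonneg x)
  refine le_trans (le_of_eq ?_) h1
  have e1 : ∀ x, ∑ i, ∑ j, (E.state x).eig i * (E.state x).overlap E.average i j *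
      (Real.log (E.average.eig j) - Real.log ((E.state x).eig i)) =
      (∑ j, (∑ i, (E.state x).eig i * (E.state x).overlap E.average i j) *
        Real.log (E.average.eig j)) - ∑ i, (E.state x).eig i * Real.log ((E.state x).eig i) := by
    intro x
    simp only [mul_sub, Finset.sum_sub_distrib]
    congr 1
    · rw [Finset.sum_comm]
      simp only [Finset.sum_mul]
    · refine Finset.sum_congr rfl fun i _ => ?_
      rw [← Finset.sum_mul, ← Finset.mul_sum, DensityMatrix.sum_overlap, mul_one]
  simp only [e1]
  simp only [mul_sub, Finset.sum_sub_distrib, holevo, DensityMatrix.entropy_eq]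
  have e2 : ∑ x, E.prob x * ∑ j, (∑ i, (E.state x).eig i * (E.state x).overlap E.average i j) *
      Real.log (E.average.eig j) = ∑ j, E.average.eig j * Real.log (E.average.eig j) := by
    simp only [Finset.mul_sum]
    rw [Finset.sum_comm]
    refine Finset.sum_congr rfl fun j _ => ?_
    have a := congrArg (· * Real.log (E.average.eig j)) (average_eig E j)
    simp only [Finset.sum_mul (s := (Finset.univ : Finset X))] at a
    rw [a]
    exact Finset.sum_congr rfl fun x _ => (mul_assoc _ _ _).symm
  rw [e2, sub_mul, div_mul_cancel₀ _ hl, Finset.sum_mul]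
  have e3 : ∀ x, E.prob x * (-(∑ i, (E.state x).eig i * Real.log ((E.state x).eig i)) /
      Real.log 2) * Real.log 2 =
      -(E.prob x * ∑ i, (E.state x).eig i * Real.log ((E.state x).eig i)) := by
    intro x
    field_simp
  simp only [e3, Finset.sum_neg_distrib]
  ring

/-! ### The pretty good measurement -/

/-- The effects `ρ^{-1/2} p_x ρ_x ρ^{-1/2}` of the pretty good measurement. -/
def prettyGoodEffect (E : Ensemble X B) (x : X) : Matrix B B ℂ :=
  E.average.specFun (fun t => (√t)⁻¹) * ((E.prob x : ℂ) • (E.state x).mat) *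
    E.average.specFun (fun t => (√t)⁻¹)

theorem prettyGoodEffect_posSemidef (E : Ensemble X B) (x : X) :
    (E.prettyGoodEffect x).PosSemidef := by
  have h := (E.prob_smul_state_posSemidef x).mul_mul_conjTranspose_same
    (E.average.specFun fun t => (√t)⁻¹)
  rwa [DensityMatrix.specFun_conjTranspose] at h

/-- Since (√0)⁻¹ = 0, the effects sum to the projection onto the support of the average state. -/
theorem one_sub_sum_prettyGoodEffect (E : Ensemble X B) :
    (1 - ∑ x, E.prettyGoodEffect x).PosSemidef := by
  have h : ∑ x, E.prettyGoodEffect x = E.average.specFun fun t => (√t)⁻¹ * t * (√t)⁻¹ := by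
    have e : E.average.specFun (fun t => (√t)⁻¹ * t * (√t)⁻¹) =
        E.average.specFun (fun t => (√t)⁻¹) * E.average.mat *
          E.average.specFun (fun t => (√t)⁻¹) := by
      rw [← E.average.specFun_id, DensityMatrix.specFun_mul, DensityMatrix.specFun_mul]
      rfl
    rw [e]
    change _ = _ * (∑ x, (E.prob x : ℂ) • (E.state x).mat) * _
    simp only [prettyGoodEffect, Matrix.mul_sum, Matrix.sum_mul]
  rw [h, ← E.average.specFun_one, DensityMatrix.specFun_sub]
  refine DensityMatrix.specFun_posSemidef _ fun i => ?_
  rcases (E.average.eig_nonneg i).eq_or_lt with h0 | h0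
  · simp [← h0]
  · have h1 : (√(E.average.eig i))⁻¹ * E.average.eig i * (√(E.average.eig i))⁻¹ = 1 := by
      have h2 := Real.sqrt_pos.mpr h0
      field_simp
      exact (Real.sq_sqrt h0.le).symm
    rw [h1, sub_self]

/-- The pretty good measurement; the outcome `x₀` is added outside the support of the average. -/
def prettyGood [DecidableEq X] (E : Ensemble X B) (x₀ : X) : POVM X B where
  effect x := E.prettyGoodEffect x + if x = x₀ then 1 - ∑ y, E.prettyGoodEffect y else 0
  posSemidef x := by
    refine (E.prettyGoodEffect_posSemidef x).add ?_
    split_ifs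
    · exact E.one_sub_sum_prettyGoodEffect
    · exact Matrix.PosSemidef.zero
  sum_eq_one := by
    rw [Finset.sum_add_distrib]
    simp

/-- The pretty good measurement guesses `x` with probability at least `p_x (Tr √ρ_x √ρ)^{-2}`. -/
theorem prob_le_prettyGood_prob_mul [DecidableEq X] (E : Ensemble X B) (x₀ x : X)
    (hx : 0 < E.prob x) :
    E.prob x ≤ (E.prettyGood x₀).prob (E.state x) x * (E.state x).affinity E.average ^ 2 := by
  have h1 := DensityMatrix.one_le_collision_mul_affinity_sq (E.suppLE_average hx)
  have h2 : E.prob x * (E.average.specFun (fun t => (√t)⁻¹) * (E.state x).mat *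
      E.average.specFun (fun t => (√t)⁻¹) * (E.state x).mat).trace.re ≤
      (E.prettyGood x₀).prob (E.state x) x := by
    have e : (E.prettyGoodEffect x * (E.state x).mat).trace.re =
        E.prob x * (E.average.specFun (fun t => (√t)⁻¹) * (E.state x).mat *
          E.average.specFun (fun t => (√t)⁻¹) * (E.state x).mat).trace.re := by
      simp only [prettyGoodEffect, Matrix.mul_smul, Matrix.smul_mul, Matrix.trace_smul, smul_eq_mul,
        Complex.re_ofReal_mul]
    rw [← e]
    simp only [POVM.prob, prettyGood, Matrix.add_mul, Matrix.trace_add, Complex.add_re]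
    refine le_add_of_nonneg_right ?_
    split_ifs
    · exact trace_mul_re_nonneg E.one_sub_sum_prettyGoodEffect (E.state x).posSemidef
    · simp
  calc E.prob x = E.prob x * 1 := (mul_one _).symm
    _ ≤ _ := mul_le_mul_of_nonneg_left h1 hx.le
    _ = _ := (mul_assoc _ _ _).symm
    _ ≤ _ := mul_le_mul_of_nonneg_right h2 (sq_nonneg _)

end Ensemble

/-! ### Joint states as matrices -/

theorem PureState.ext_amp {S : Type} [Fintype S] {ψ φ : PureState S} (h : ∀ s, ψ.amp s = φ.amp s) :
    ψ = φ := by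
  cases ψ
  cases φ
  congr
  exact funext h

theorem PureState.nonempty {S : Type} [Fintype S] (ψ : PureState S) : Nonempty S := by
  by_contra h
  rw [not_nonempty_iff] at h
  simpa using ψ.norm_eq_one

section Steps

variable {A B C : Type} [Fintype A] [Fintype B] [Fintype C]

/-- The amplitudes of a joint state, with rows indexed by Bob's machine. -/
def bobMatrix (ψ : PureState (A × B × C)) : Matrix B (A × C) ℂ :=
  Matrix.of fun b t => ψ.amp (t.1, b, t.2)

/-- The amplitudes of a joint state, with rows indexed by Alice's machine. -/
def aliceMatrix (ψ : PureState (A × B × C)) : Matrix A (B × C) ℂ :=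
  Matrix.of fun a t => ψ.amp (a, t)

theorem bobReduced_mat (ψ : PureState (A × B × C)) :
    (bobReduced ψ).mat = bobMatrix ψ * (bobMatrix ψ).conjTranspose := rfl

theorem bobMatrix_injective {ψ φ : PureState (A × B × C)} (h : bobMatrix ψ = bobMatrix φ) :
    ψ = φ :=
  PureState.ext_amp fun s => congrFun (congrFun h s.2.1) (s.1, s.2.2)

theorem trace_aliceMatrix_mul (ψ φ : PureState (A × B × C)) :
    (aliceMatrix ψ * (aliceMatrix φ).conjTranspose).trace =
      (bobMatrix ψ * (bobMatrix φ).conjTranspose).trace := by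
  simp only [Matrix.trace, Matrix.diag_apply, Matrix.mul_apply, Matrix.conjTranspose_apply,
    aliceMatrix, bobMatrix, Matrix.of_apply, Fintype.sum_prod_type]
  exact Finset.sum_comm

/-- In this picture Alice's unitaries multiply from the right, which is the freedom in choosing a
purification of Bob's state. -/
theorem bobMatrix_aliceStep [DecidableEq A] [DecidableEq C] (U : Matrix.unitaryGroup (A × C) ℂ)
    (ψ : PureState (A × B × C)) :
    bobMatrix (aliceStep U ψ) = bobMatrix ψ * (U : Matrix (A × C) (A × C) ℂ).transpose := by
  ext b t
  simp only [bobMatrix, aliceStep, Matrix.of_apply, Matrix.mul_apply, Matrix.transpose_apply]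
  exact Finset.sum_congr rfl fun s _ => mul_comm _ _

theorem aliceMatrix_bobStep [DecidableEq B] [DecidableEq C] (V : Matrix.unitaryGroup (B × C) ℂ)
    (ψ : PureState (A × B × C)) :
    aliceMatrix (bobStep V ψ) = aliceMatrix ψ * (V : Matrix (B × C) (B × C) ℂ).transpose := by
  ext b t
  simp only [aliceMatrix, bobStep, Matrix.of_apply, Matrix.mul_apply, Matrix.transpose_apply]
  exact Finset.sum_congr rfl fun s _ => mul_comm _ _

theorem transpose_mul_conjTranspose {T : Type} [Fintype T] [DecidableEq T]
    (U : Matrix.unitaryGroup T ℂ) :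
    (U : Matrix T T ℂ).transpose * (U : Matrix T T ℂ).transpose.conjTranspose = 1 := by
  change _ * (U : Matrix T T ℂ).conjTranspose.transpose = 1
  rw [← Matrix.transpose_mul, ← Matrix.star_eq_conjTranspose,
    Matrix.UnitaryGroup.star_mul_self, Matrix.transpose_one]

theorem mul_transpose_mul_conjTranspose {S T : Type} [Fintype T] [DecidableEq T]
    (M N : Matrix S T ℂ) (U : Matrix.unitaryGroup T ℂ) :
    M * (U : Matrix T T ℂ).transpose * (N * (U : Matrix T T ℂ).transpose).conjTranspose =
      M * N.conjTranspose := by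
  rw [Matrix.conjTranspose_mul, Matrix.mul_assoc, ← Matrix.mul_assoc (Matrix.transpose _),
    transpose_mul_conjTranspose, Matrix.one_mul]

variable [DecidableEq A] [DecidableEq C]

theorem aliceStep_mul (U W : Matrix.unitaryGroup (A × C) ℂ) (ψ : PureState (A × B × C)) :
    aliceStep (U * W) ψ = aliceStep U (aliceStep W ψ) := by
  apply bobMatrix_injective
  rw [bobMatrix_aliceStep, bobMatrix_aliceStep, bobMatrix_aliceStep, Matrix.mul_assoc,
    ← Matrix.transpose_mul]
  rfl

variable [DecidableEq B]

/-- The trace is the inner product of the two joint states, and both parties act unitarily. -/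
theorem trace_evolve (U : ℕ → Matrix.unitaryGroup (A × C) ℂ) (V : ℕ → Matrix.unitaryGroup (B × C) ℂ)
    (ψ φ : PureState (A × B × C)) (k : ℕ) :
    (bobMatrix (evolve U V ψ k) * (bobMatrix (evolve U V φ k)).conjTranspose).trace =
      (bobMatrix ψ * (bobMatrix φ).conjTranspose).trace := by
  induction k with
  | zero => rfl
  | succ k ih =>
    simp only [evolve]
    rw [← trace_aliceMatrix_mul, aliceMatrix_bobStep, aliceMatrix_bobStep,
      mul_transpose_mul_conjTranspose, trace_aliceMatrix_mul, bobMatrix_aliceStep,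
      bobMatrix_aliceStep, mul_transpose_mul_conjTranspose, ih]

/-- A unitary of Alice before the first round can be absorbed into her first unitary. -/
theorem evolve_absorb (U : ℕ → Matrix.unitaryGroup (A × C) ℂ)
    (V : ℕ → Matrix.unitaryGroup (B × C) ℂ) (W : Matrix.unitaryGroup (A × C) ℂ)
    (ψ : PureState (A × B × C)) (k : ℕ) :
    evolve (fun i => if i = 0 then U 0 * W else U i) V ψ (k + 1) =
      evolve U V (aliceStep W ψ) (k + 1) := by
  induction k with
  | zero => simp [evolve, aliceStep_mul]
  | succ k ih =>
    rw [evolve, ih, evolve.eq_2 U V _ (k + 1)]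
    simp only [Nat.succ_ne_zero, if_false]

end Steps

/-! ### Superpositions over a register of Alice -/

section Register

variable {R A B C : Type} [Fintype R] [Fintype A] [Fintype B] [Fintype C]

/-- The state `∑ r, w r |r⟩ ⊗ α r` of an enlarged machine. -/
def superposeInit (w : PureState R) (α : R → PureState A) : PureState (R × A) where
  amp s := w.amp s.1 * (α s.1).amp s.2
  norm_eq_one := by
    simp only [Fintype.sum_prod_type, norm_mul, mul_pow]
    simp only [← Finset.mul_sum, PureState.norm_eq_one, mul_one]

/-- The joint state `∑ r, w r |r⟩ ⊗ φ r`. -/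
def superpose (w : PureState R) (φ : R → PureState (A × B × C)) :
    PureState ((R × A) × B × C) where
  amp s := w.amp s.1.1 * (φ s.1.1).amp (s.1.2, s.2)
  norm_eq_one := by
    have h : ∀ r, ∑ a, ∑ t : B × C, ‖(φ r).amp (a, t)‖ ^ 2 = 1 := fun r => by
      rw [← Fintype.sum_prod_type (f := fun s => ‖(φ r).amp s‖ ^ 2)]
      exact (φ r).norm_eq_one
    rw [Fintype.sum_prod_type, Fintype.sum_prod_type]
    simp only [norm_mul, mul_pow, ← Finset.mul_sum, h, mul_one, w.norm_eq_one]

theorem superposeInit_prod (w : PureState R) (α : R → PureState A) (β : PureState B)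
    (γ : PureState C) :
    (superposeInit w α).prod β γ = superpose w fun r => (α r).prod β γ :=
  PureState.ext_amp fun s => by
    simp only [PureState.prod, superposeInit, superpose, mul_assoc]

/-- Tracing out the register removes the cross terms, so Bob sees a mixture rather than a
superposition. -/
theorem bobReduced_superpose_mat (w : PureState R) (φ : R → PureState (A × B × C)) :
    (bobReduced (superpose w φ)).mat = ∑ r, ((‖w.amp r‖ ^ 2 : ℝ) : ℂ) • (bobReduced (φ r)).mat := by
  ext b b'
  rw [Matrix.sum_apply]
  simp only [bobReduced, superpose, Matrix.of_apply, Matrix.smul_apply, Fintype.sum_prod_type,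
    smul_eq_mul, Finset.mul_sum]
  refine Finset.sum_congr rfl fun r _ => Finset.sum_congr rfl fun a _ =>
    Finset.sum_congr rfl fun c _ => ?_
  rw [star_mul', Complex.ofReal_pow, ← Complex.mul_conj', RCLike.star_def]
  ring

variable [DecidableEq C]

theorem bobStep_superpose [DecidableEq B] (V : Matrix.unitaryGroup (B × C) ℂ) (w : PureState R)
    (φ : R → PureState (A × B × C)) :
    bobStep V (superpose w φ) = superpose w fun r => bobStep V (φ r) := by
  refine PureState.ext_amp fun s => ?_
  simp only [bobStep, superpose, Finset.mul_sum]
  exact Finset.sum_congr rfl fun t _ => by ring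

variable [DecidableEq R] [DecidableEq A]

open scoped Kronecker in
/-- The unitary `U` on the enlarged machine, acting trivially on the register. -/
def liftUnitary (R : Type) [Fintype R] [DecidableEq R] (U : Matrix.unitaryGroup (A × C) ℂ) :
    Matrix.unitaryGroup ((R × A) × C) ℂ :=
  ⟨((1 : Matrix R R ℂ) ⊗ₖ (U : Matrix (A × C) (A × C) ℂ)).submatrix
      (Equiv.prodAssoc R A C) (Equiv.prodAssoc R A C), by
    have h := Matrix.mem_unitaryGroup_iff.mp (Matrix.kronecker_mem_unitary
      (one_mem (Matrix.unitaryGroup R ℂ)) U.2)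
    rw [Matrix.mem_unitaryGroup_iff, Matrix.star_eq_conjTranspose,
      Matrix.conjTranspose_submatrix, Matrix.submatrix_mul_equiv, ← Matrix.star_eq_conjTranspose, h,
      Matrix.submatrix_one_equiv]⟩

theorem liftUnitary_apply (U : Matrix.unitaryGroup (A × C) ℂ) (r r' : R) (a a' : A) (c c' : C) :
    (liftUnitary R U : Matrix ((R × A) × C) ((R × A) × C) ℂ) ((r, a), c) ((r', a'), c') =
      if r = r' then (U : Matrix (A × C) (A × C) ℂ) (a, c) (a', c') else 0 := by
  change (1 : Matrix R R ℂ) r r' * (U : Matrix (A × C) (A × C) ℂ) (a, c) (a', c') = _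
  rw [Matrix.one_apply, ite_mul, one_mul, zero_mul]

theorem aliceStep_superpose (U : Matrix.unitaryGroup (A × C) ℂ) (w : PureState R)
    (φ : R → PureState (A × B × C)) :
    aliceStep (liftUnitary R U) (superpose w φ) = superpose w fun r => aliceStep U (φ r) := by
  refine PureState.ext_amp fun s => ?_
  obtain ⟨⟨r, a⟩, b, c⟩ := s
  simp only [aliceStep, superpose, Fintype.sum_prod_type, liftUnitary_apply, ite_mul, zero_mul]
  rw [Finset.sum_eq_single r]
  · simp only [if_true, Finset.mul_sum]
    refine Finset.sum_congr rfl fun a' _ => Finset.sum_congr rfl fun c' _ => by ring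
  · intro r' _ hr
    simp [hr.symm]
  · simp

variable [DecidableEq B]

theorem evolve_superpose (U : ℕ → Matrix.unitaryGroup (A × C) ℂ)
    (V : ℕ → Matrix.unitaryGroup (B × C) ℂ) (w : PureState R)
    (φ : R → PureState (A × B × C)) (k : ℕ) :
    evolve (fun i => liftUnitary R (U i)) V (superpose w φ) k =
      superpose w fun r => evolve U V (φ r) k := by
  induction k with
  | zero => rfl
  | succ k ih => simp only [evolve, ih, aliceStep_superpose, bobStep_superpose]

/-- A basis state. -/
def basisState (r : R) : PureState R where
  amp s := if s = r then 1 else 0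
  norm_eq_one := by
    simp [apply_ite]

/-- The uniform superposition of the basis states. -/
def uniformState (R : Type) [Fintype R] [Nonempty R] : PureState R where
  amp _ := ((√(Fintype.card R : ℝ))⁻¹ : ℝ)
  norm_eq_one := by
    simp

theorem uniformState_norm_sq (R : Type) [Fintype R] [Nonempty R] (r : R) :
    ‖(uniformState R).amp r‖ ^ 2 = (Fintype.card R : ℝ)⁻¹ := by
  simp [uniformState]

end Register

/-! ### Cheating by an honest commitment to a superposition -/

theorem DensityMatrix.affinity_comm {B : Type} [Fintype B] [DecidableEq B]
    (ρ σ : DensityMatrix B) : ρ.affinity σ = σ.affinity ρ := by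
  unfold DensityMatrix.affinity
  rw [Finset.sum_comm]
  refine Finset.sum_congr rfl fun j _ => Finset.sum_congr rfl fun i _ => ?_
  rw [DensityMatrix.overlap_comm]
  ring

theorem affinity_sq_le_prob {ι B : Type} [Fintype ι] [Fintype B] [DecidableEq B] (M : POVM ι B)
    (ρ σ : DensityMatrix B) (i : ι) (h : M.prob ρ i = 1) : ρ.affinity σ ^ 2 ≤ M.prob σ i := by
  have hs : ∀ τ : DensityMatrix B,
      τ.specFun Real.sqrt * (τ.specFun Real.sqrt).conjTranspose = τ.mat := fun τ => by
    rw [τ.specFun_conjTranspose, τ.specFun_sqrt_mul_self]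
  have key := norm_trace_sq_le_effect (M.posSemidef i) (M.one_sub_effect_posSemidef i)
    (σ.specFun Real.sqrt) (ρ.specFun Real.sqrt) (by rw [hs, ρ.trace_eq_one]) (by rw [hs]; exact h)
  rwa [hs, ρ.specFun_conjTranspose, DensityMatrix.trace_sqrt_mul_sqrt, Complex.norm_real,
    Real.norm_eq_abs, sq_abs, DensityMatrix.affinity_comm] at key

namespace Protocol

variable {n : ℕ} (P : Protocol n)

theorem norm_trace_sq_le_acceptProb {A' : Type} [Fintype A'] [DecidableEq A']
    (ψ φ : PureState (A' × P.B × P.C)) (U : ℕ → Matrix.unitaryGroup (A' × P.C) ℂ) (x : BitString n)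
    (h : P.acceptProb φ U x = 1) :
    ‖(bobMatrix ψ * (bobMatrix φ).conjTranspose).trace‖ ^ 2 ≤ P.acceptProb ψ U x := by
  rw [← trace_evolve U P.bobReveal ψ φ P.revealRounds]
  exact norm_trace_sq_le_effect (P.opening.posSemidef _) (P.opening.one_sub_effect_posSemidef _)
    _ _ (bobReduced (evolve U P.bobReveal φ P.revealRounds)).trace_eq_one h

theorem acceptProb_superpose {R : Type} [Fintype R] [DecidableEq R] (w : PureState R)
    (φ : R → PureState (P.A × P.B × P.C)) (x : BitString n) :
    P.acceptProb (superpose w φ) (fun k => liftUnitary R (P.aliceReveal k)) x =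
      ∑ r, ‖w.amp r‖ ^ 2 * P.acceptProb (φ r) P.aliceReveal x := by
  simp only [acceptProb, POVM.prob, evolve_superpose, bobReduced_superpose_mat, Matrix.mul_sum,
    Matrix.mul_smul, Matrix.trace_sum, Matrix.trace_smul, smul_eq_mul, Complex.re_sum,
    Complex.re_ofReal_mul]

theorem afterCommit_superpose {R : Type} [Fintype R] [DecidableEq R] (w : PureState R)
    (f : R → BitString n) :
    P.afterCommit (superposeInit w fun r => P.aliceInit (f r))
        (fun k => liftUnitary R (P.aliceCommit k)) =
      superpose w fun r => P.honestState (f r) := by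
  simp only [afterCommit, superposeInit_prod, evolve_superpose]
  rfl

/-- The attack: commit to a uniform superposition, then steer the purification towards the honest
commitment to x before revealing. -/
theorem sum_affinity_sq_le_of_binding {a : ℝ} (hc : P.Correct) (hb : P.Binding a) :
    ∑ x, (P.ensemble.state x).affinity P.ensemble.average ^ 2 ≤ (2 : ℝ) ^ a := by
  have : Nonempty P.B := P.bobInit.nonempty
  obtain ⟨b₀⟩ := P.bobInit.nonempty
  obtain ⟨c₀⟩ := P.channelInit.nonempty
  -- The extra factor `P.B` carries no information; it makes Alice's side large enough to contain a
  -- copy of Bob's space, as the embedding in `hW` requires.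
  let R := BitString n × P.B
  let Ψ : PureState ((R × P.A) × P.B × P.C) :=
    superpose (uniformState R) fun r => P.honestState r.1
  -- The honest commitment to x, placed in the enlarged machine so that it can be compared with Ψ.
  let Φ : BitString n → PureState ((R × P.A) × P.B × P.C) := fun x =>
    superpose (basisState (x, b₀)) fun r => P.honestState r.1
  have hΨ : (bobReduced Ψ).mat = P.ensemble.average.mat := by
    rw [bobReduced_superpose_mat]
    simp only [uniformState_norm_sq, R, Fintype.sum_prod_type, Finset.sum_const, Finset.card_univ,
      Fintype.card_prod]
    change _ = ∑ x, (((2 : ℝ) ^ n)⁻¹ : ℝ) • (bobReduced (P.honestState x)).mat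
    refine Finset.sum_congr rfl fun x _ => ?_
    have hB : (Fintype.card P.B : ℝ) ≠ 0 := by exact_mod_cast Fintype.card_ne_zero
    rw [← Nat.cast_smul_eq_nsmul ℝ, Complex.coe_smul, smul_smul]
    congr 1
    simp only [Fintype.card_pi_const, Fintype.card_bool]
    push_cast
    field_simp
  have hΦ : ∀ x, (bobReduced (Φ x)).mat = (P.ensemble.state x).mat := by
    intro x
    rw [bobReduced_superpose_mat, Finset.sum_eq_single (x, b₀)]
    · simp [basisState, ensemble]
    · intro r _ hr
      simp [basisState, hr]
    · simp
  have hacc : ∀ x, P.acceptProb (Φ x) (fun k => liftUnitary R (P.aliceReveal k)) x = 1 := by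
    intro x
    rw [acceptProb_superpose, Finset.sum_eq_single (x, b₀)]
    · simp [basisState, hc x]
    · intro r _ hr
      simp [basisState, hr]
    · simp
  have hW : ∀ x, ∃ W : Matrix.unitaryGroup ((R × P.A) × P.C) ℂ,
      (bobMatrix (aliceStep W Ψ) * (bobMatrix (Φ x)).conjTranspose).trace =
        (P.ensemble.average.affinity (P.ensemble.state x) : ℂ) := by
    intro x
    obtain ⟨a₀⟩ := (P.aliceInit x).nonempty
    obtain ⟨W, hW, h⟩ := exists_unitary_trace_eq_affinity P.ensemble.average (P.ensemble.state x)
      (bobMatrix Ψ) (bobMatrix (Φ x)) ⟨fun b => (((x, b), a₀), c₀), fun b b' h =>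
        congrArg (fun t : (R × P.A) × P.C => t.1.1.2) h⟩
      ((bobReduced_mat Ψ).symm.trans hΨ) ((bobReduced_mat (Φ x)).symm.trans (hΦ x))
    refine ⟨⟨W.transpose, Matrix.mem_unitaryGroup_iff.mpr ?_⟩, ?_⟩
    · rw [Matrix.star_eq_conjTranspose]
      exact transpose_mul_conjTranspose ⟨W, hW⟩
    · rw [bobMatrix_aliceStep, Matrix.transpose_transpose, h]
  choose W hW using hW
  have h := hb (R × P.A) (superposeInit (uniformState R) fun r => P.aliceInit r.1)
    (fun k => liftUnitary R (P.aliceCommit k))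
    (fun x k => if k = 0 then liftUnitary R (P.aliceReveal 0) * W x
      else liftUnitary R (P.aliceReveal k))
  rw [P.afterCommit_superpose] at h
  refine le_trans (Finset.sum_le_sum fun x _ => ?_) h
  -- Without reveal rounds Alice cannot apply W. Then Bob's measurement already accepts x with
  -- certainty on ρ_x, and the same bound holds for it on ρ. Otherwise W is absorbed into her first
  -- reveal unitary.
  rcases hr : P.revealRounds with _ | k
  · have h1 : P.opening.prob (P.ensemble.state x) (some x) = 1 := by
      have := hc x
      rwa [acceptProb, hr] at this
    have h2 := affinity_sq_le_prob P.opening _ P.ensemble.average _ h1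
    refine h2.trans (le_of_eq ?_)
    rw [acceptProb, hr, POVM.prob, POVM.prob]
    exact congrArg (fun M => (P.opening.effect (some x) * M).trace.re) hΨ.symm
  · have h1 := P.norm_trace_sq_le_acceptProb (aliceStep (W x) Ψ) (Φ x) _ x (hacc x)
    rw [hW, Complex.norm_real, Real.norm_eq_abs, sq_abs, DensityMatrix.affinity_comm] at h1
    refine h1.trans (le_of_eq ?_)
    rw [acceptProb, acceptProb, hr,
      ← evolve_absorb (fun i => liftUnitary R (P.aliceReveal i)) P.bobReveal (W x) Ψ k]

/-! ### The trade-off n ≤ a + b -/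

theorem ensemble_prob_pos (x : BitString n) : 0 < P.ensemble.prob x :=
  inv_pos.mpr (by positivity)

theorem le_add_of_rpow_le {a b : ℝ} (h : (2 : ℝ) ^ n ≤ (2 : ℝ) ^ b * (2 : ℝ) ^ a) :
    (n : ℝ) ≤ a + b := by
  rw [← Real.rpow_natCast, ← Real.rpow_add two_pos, Real.rpow_le_rpow_left_iff one_lt_two] at h
  linarith

/-- Every bit string commitment satisfies `n ≤ a + b`. -/
theorem IsQBSC.le_add {P : Protocol n} {a b : ℝ} (h : P.IsQBSC a b) : (n : ℝ) ≤ a + b := by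
  have hA := P.sum_affinity_sq_le_of_binding h.correct h.binding
  have hB := h.concealing (P.ensemble.prettyGood fun _ => false)
  have hnn : ∀ x, 0 ≤ (P.ensemble.prettyGood fun _ => false).prob (P.ensemble.state x) x := fun x =>
    trace_mul_re_nonneg (POVM.posSemidef _ _) (P.ensemble.state x).posSemidef
  -- Each product q_x T_x² is at least 2^{-n}, and the square of the sum of 2^n copies of 2^{-n/2}
  -- is 2^n.
  have hcs := Finset.sum_sq_le_sum_mul_sum_of_sq_le_mul Finset.univ
    (r := fun _ : BitString n => √(((2 : ℝ) ^ n)⁻¹)) (fun x _ => hnn x)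
    (g := fun x => (P.ensemble.state x).affinity P.ensemble.average ^ 2) (fun x _ => sq_nonneg _)
    (fun x _ => by
      rw [Real.sq_sqrt (by positivity)]
      exact P.ensemble.prob_le_prettyGood_prob_mul _ x (P.ensemble_prob_pos x))
  refine le_add_of_rpow_le (le_trans (le_of_eq ?_) (hcs.trans
    (mul_le_mul hB hA (Finset.sum_nonneg fun _ _ => sq_nonneg _) (by positivity))))
  rw [Finset.sum_const, Finset.card_univ, nsmul_eq_mul, mul_pow, Real.sq_sqrt (by positivity)]
  simp only [Fintype.card_pi_const, Fintype.card_bool]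
  push_cast
  field_simp

/-- Every bit string commitment satisfies `n ≤ a + b`, with the Holevo information as measure of
concealment. -/
theorem IsQBSCHolevo.le_add {P : Protocol n} {a b : ℝ} (h : P.IsQBSCHolevo a b) :
    (n : ℝ) ≤ a + b := by
  have hA := P.sum_affinity_sq_le_of_binding h.correct h.binding
  have hl := Real.log_pos one_lt_two
  set T := fun x => (P.ensemble.state x).affinity P.ensemble.average
  have hT : ∀ x, 0 < T x := fun x =>
    DensityMatrix.affinity_pos (P.ensemble.suppLE_average (P.ensemble_prob_pos x))
  have h1 := P.ensemble.neg_holevo_le_sum_log_affinity P.ensemble_prob_pos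
  -- Jensen: the mean of log T_x² is at most the logarithm of the mean, which the binding condition
  -- bounds.
  have h2 := strictConcaveOn_log_Ioi.concaveOn.le_map_sum (t := Finset.univ)
    (w := P.ensemble.prob) (p := fun x => T x ^ 2) (fun x _ => P.ensemble.prob_nonneg x)
    P.ensemble.prob_sum (fun x _ => Set.mem_Ioi.mpr (pow_pos (hT x) 2))
  simp only [smul_eq_mul, Real.log_pow, Nat.cast_ofNat] at h2
  have h3 : ∑ x, P.ensemble.prob x * T x ^ 2 = ((2 : ℝ) ^ n)⁻¹ * ∑ x, T x ^ 2 := by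
    rw [Finset.mul_sum]
    rfl
  have hS : 0 < ∑ x, T x ^ 2 :=
    Finset.sum_pos (fun x _ => pow_pos (hT x) 2) Finset.univ_nonempty
  rw [h3, Real.log_mul (by positivity) hS.ne', Real.log_inv, Real.log_pow] at h2
  have h4 : Real.log (∑ x, T x ^ 2) ≤ a * Real.log 2 := by
    rw [← Real.log_rpow two_pos]
    exact Real.log_le_log hS hA
  have h5 : P.ensemble.holevo * Real.log 2 ≤ b * Real.log 2 :=
    mul_le_mul_of_nonneg_right h.concealing hl.le
  have h6 := h1.trans h2
  have h7 : (n : ℝ) * Real.log 2 ≤ (a + b) * Real.log 2 := by linarith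
  exact le_of_mul_le_mul_right h7 hl

end Protocol

end QBSC

end

/-! ### Parallel repetition -/

theorem mainTheorem2 :
    -- If `P` is an `(n,a,b)`-QBSC and `P^m` is an `(mn,ma,mb)`-QBSC, then `n < a + b + c/m`.
    (∀ (n : ℕ) (P : QBSC.Protocol n) (a b : ℝ) (m : ℕ), 0 < m →
      P.IsQBSC a b → (P.parallel m).IsQBSC (m * a) (m * b) →
      (n : ℝ) < a + b + (5 * Real.logb 2 5 - 4) / m) ∧
    -- If `a + b < n`, then only finitely many parallel repetitions can be secure.
    (∀ (n : ℕ) (P : QBSC.Protocol n) (a b : ℝ), a + b < n →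
      ∃ M : ℕ, ∀ m ≥ M, ¬ (P.parallel m).IsQBSC (m * a) (m * b)) ∧
    -- The same for the Holevo information.
    (∀ (n : ℕ) (P : QBSC.Protocol n) (a b : ℝ), a + b < n →
      ∃ M : ℕ, ∀ m ≥ M, ¬ (P.parallel m).IsQBSCHolevo (m * a) (m * b)) := by
  have scale : ∀ (n m : ℕ) (a b : ℝ), 0 < m →
      ((m * n : ℕ) : ℝ) ≤ m * a + m * b → (n : ℝ) ≤ a + b := by
    intro n m a b hm h
    have hm' : (0 : ℝ) < m := Nat.cast_pos.mpr hm
    rw [Nat.cast_mul, ← mul_add] at h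
    exact le_of_mul_le_mul_left h hm'
  -- The threshold is M = 1: `scale` divides by m, so m = 0 has to be excluded.
  refine ⟨fun n P a b m hm _ h => ?_, fun n P a b hab => ⟨1, fun m hm h => ?_⟩,
    fun n P a b hab => ⟨1, fun m hm h => ?_⟩⟩
  · have hc : 0 < (5 * Real.logb 2 5 - 4) / (m : ℝ) := by
      refine div_pos ?_ (Nat.cast_pos.mpr hm)
      -- This crude bound gives c ≥ 1, and only c > 0 is needed to make the inequality strict.
      have : 1 ≤ Real.logb 2 5 := by
        rw [Real.le_logb_iff_rpow_le one_lt_two (by norm_num)]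
        norm_num
      linarith
    linarith [scale n m a b hm h.le_add]
  · linarith [scale n m a b hm h.le_add]
  · linarith [scale n m a b hm h.le_add]
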